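/- Let $(Q,\mathfrak n,k)$ be a Noetherian local ring, $\varphi: Q\to R$ a surjective homomorphism onto a nonzero ring $R$ (so $R$ is local with residue field $k$), and $M$ a finitely generated $R$-module. For a Noetherian local ring $S$ with residue field $k$ and a finitely generated $S$-module $N$, let $P^S_N(t)=\sum_{n\ge 0}\dim_k \operatorname{Tor}^S_n(N,k)\,t^n$ be the Poincaré series of $N$. Recall the Golod bound, the classical coefficientwise inequality of power series $$P^R_M(t)\ \le\ \frac{P^Q_M(t)}{1-t\,(P^Q_R(t)-1)}.$$ By definition $M$ is $\varphi$-Golod if this inequality is an equality. (1) Suppose that $c=\max\{\operatorname{pd}_Q R,\ \operatorname{pd}_Q M-1\}$ is finite. If the coefficients of $t^i$ on the two sides of the Golod bound agree for all $i\le c+1$, then $M$ is $\varphi$-Golod. (2) In particular, suppose that $Q$ is a regular local ring of Krull dimension $d$. If the coefficients of $t^i$ on the two sides of the Golod bound agree for all $i\le d+1$, then $M$ is $\varphi$-Golod. -/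

import Mathlib

universe u

open CategoryTheory

open scoped ChangeOfRings TensorProduct in
/-- Base change along a homomorphism of commutative rings is an additive functor. -/
instance extendScalars_additive {R S : Type u} [CommRing R] [CommRing S] (f : R →+* S) :
    (ModuleCat.extendScalars.{u, u, u} f).Additive where
  map_add {M N g h} := by
    let _ := Module.compHom S f
    refine ModuleCat.ExtendScalars.hom_ext (f := f) ?_
    intro m
    change (1 : S) ⊗ₜ[R] (g + h).hom m = (1 : S) ⊗ₜ[R] g.hom m + (1 : S) ⊗ₜ[R] h.hom m
    rw [ModuleCat.hom_add, LinearMap.add_apply, TensorProduct.tmul_add]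

/-- For a local ring `R` with residue field `k` and an `R`-module `M`, the `k`-vector space
`Tor_n^R(M, k)`: the value at `M` of the `n`-th left derived functor of the base change functor
`M ↦ k ⊗[R] M` from `R`-modules to `k`-vector spaces. -/
noncomputable def residueTor (R : Type u) [CommRing R] [IsLocalRing R]
    (M : Type u) [AddCommGroup M] [Module R M] (n : ℕ) :
    ModuleCat.{u} (IsLocalRing.ResidueField R) :=
  ((ModuleCat.extendScalars.{u, u, u} (IsLocalRing.residue R)).leftDerived n).obj
    (ModuleCat.of R M)

/-- The Poincaré series `P^R_M = ∑ₙ dim_k Tor_n^R(M, k) tⁿ`, for a finitely generated module `M`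
over a Noetherian local ring `R` (so that all the dimensions are finite). -/
noncomputable def poincareSeries (R : Type u) [CommRing R] [IsLocalRing R]
    (M : Type u) [AddCommGroup M] [Module R M] : PowerSeries ℚ :=
  PowerSeries.mk fun n =>
    (Module.finrank (IsLocalRing.ResidueField R) (residueTor R M n) : ℚ)

/-- The denominator `1 - t (P^Q_R - 1)` of the Golod bound. -/
noncomputable def golodDenominator (Q R : Type u) [CommRing Q] [IsLocalRing Q]
    [CommRing R] [Algebra Q R] : PowerSeries ℚ :=
  1 - PowerSeries.X * (poincareSeries Q R - 1)

/-- The Golod bound `P^Q_M / (1 - t (P^Q_R - 1))`, as a formal power series. -/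
noncomputable def golodBound (Q R M : Type u) [CommRing Q] [IsLocalRing Q]
    [CommRing R] [Algebra Q R] [AddCommGroup M] [Module Q M] : PowerSeries ℚ :=
  poincareSeries Q M * (golodDenominator Q R)⁻¹

/-- The denominator has constant coefficient `1`, so its inverse above is a genuine inverse. -/
theorem golodBound_mul_golodDenominator (Q R M : Type u) [CommRing Q] [IsLocalRing Q]
    [CommRing R] [Algebra Q R] [AddCommGroup M] [Module Q M] :
    golodBound Q R M * golodDenominator Q R = poincareSeries Q M := by
  have h : PowerSeries.constantCoeff (golodDenominator Q R) ≠ 0 := by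
    simp [golodDenominator]
  rw [golodBound, mul_assoc, PowerSeries.inv_mul_cancel _ h, mul_one]

/-- A finitely generated `R`-module `M` is `φ`-Golod, for `φ : Q → R` the structure map, if the
Golod bound for `M` is an equality. -/
def IsGolodModule (Q R M : Type u) [CommRing Q] [IsLocalRing Q] [CommRing R] [IsLocalRing R]
    [Algebra Q R] [AddCommGroup M] [Module Q M] [Module R M] : Prop :=
  poincareSeries R M = golodBound Q R M

/-- The Golod bound for `M` is an equality up to, and including, the coefficient of `t ^ N`. -/
def GolodBoundEqUpTo (Q R M : Type u) [CommRing Q] [IsLocalRing Q] [CommRing R] [IsLocalRing R]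
    [Algebra Q R] [AddCommGroup M] [Module Q M] [Module R M] (N : ℕ) : Prop :=
  ∀ i ≤ N, PowerSeries.coeff i (poincareSeries R M) = PowerSeries.coeff i (golodBound Q R M)

/-! Take minimal free resolutions over `Q`: `A` of `R` and `B` of `M`. From them one builds a free
resolution of `M` over `R` whose ranks are exactly the coefficients of the Golod bound. Comparing
these ranks with Tor shows that `M` is Golod as soon as the resolution is minimal. Its differential
is determined by finitely many pieces of data in degrees at most `c + 1`, so minimality can be
tested there.

The resolution is a bar construction, handled through its dual. Let `S` be a basis of the positive
part of `A` with degrees raised by one, and `U` a basis of `B`. An A-infinity structure on `A` is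
encoded by an odd derivation of the tensor algebra on `S` whose linear part is the transposed
differential of `A`. The component `A_1 → Q` appears as a curvature: the square of the derivation is
the commutator with the linear form `h`. An A-infinity module structure on `B` is likewise a
connection on the free module on `U`, chosen so that the square of the total operator is
multiplication by `h`. Both are built degree by degree (`exists_curved`, `exists_connection`): the
current defect is a cycle with coefficients in the tensor algebra, and exactness over `Q` provides
the correction.

Since `h` generates the kernel of `Q → R`, the transposed operator squares to zero over `R`.
Filtering words by the degree of what follows the first letter reduces its exactness to that of `A`
and `B` (`IsTwisting.exact`, `IsTwisting.isFreeResolution`). Counting words recursively gives the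
Golod bound (`golodBound_eq`).

Equality of coefficients through degree `c + 1` makes the differentials vanish over the residue
field in that range (`IsTwisting.isGolodModule`). The range contains the values on all letters and
all elements of `U`; by the Leibniz rule these generate the whole differential, which therefore
vanishes over the residue field in every degree. For regular `Q`, minimal resolutions stop at the
dimension (`isEmpty_of_isRegularLocalRing`). -/

namespace GolodBound

/-! ### Signed derivations of the tensor algebra. -/

section TensorAlgebra

variable {Q : Type*} [CommRing Q] {S : Type*}

/-- Noncommutative polynomials over `Q` in the letters `S`. -/
abbrev Tens (Q : Type*) [CommRing Q] (S : Type*) := MonoidAlgebra Q (FreeMonoid S)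

/-- The word `w` as a noncommutative monomial. -/
noncomputable def mon (Q : Type*) [CommRing Q] {S : Type*} (w : FreeMonoid S) : Tens Q S :=
  MonoidAlgebra.single w 1

/-- The letter `s` as a noncommutative polynomial. -/
noncomputable def letter (Q : Type*) [CommRing Q] {S : Type*} (s : S) : Tens Q S :=
  mon Q (FreeMonoid.of s)

/-- Extension of a function on words to a linear map. -/
noncomputable def extend {N : Type*} [AddCommGroup N] [Module Q N] (v : FreeMonoid S → N) :
    Tens Q S →ₗ[Q] N :=
  Finsupp.linearCombination Q v ∘ₗ (MonoidAlgebra.coeffLinearEquiv Q).toLinearMap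

section

variable {N : Type*} [AddCommGroup N] [Module Q N]

theorem extend_mon (v : FreeMonoid S → N) (w : FreeMonoid S) : extend v (mon Q w) = v w := by
  simp [extend, mon]

theorem extend_apply (v : FreeMonoid S → N) (t : Tens Q S) :
    extend v t = t.coeff.sum fun w c => c • v w := rfl

theorem linearMap_ext {φ ψ : Tens Q S →ₗ[Q] N} (h : ∀ w, φ (mon Q w) = ψ (mon Q w)) : φ = ψ := by
  refine MonoidAlgebra.lhom_ext' fun w => LinearMap.ext_ring ?_
  simpa [mon] using h w

theorem mon_mul (w w' : FreeMonoid S) : mon Q (w * w') = mon Q w * mon Q w' := by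
  simp [mon]

theorem mon_one : mon Q (1 : FreeMonoid S) = 1 := rfl

theorem mem_of_supported {X : Set (FreeMonoid S)} {φ : Tens Q S →ₗ[Q] N} {P : Submodule Q N}
    (h : ∀ w ∈ X, φ (mon Q w) ∈ P) {t : Tens Q S} (ht : ∀ w, t.coeff w ≠ 0 → w ∈ X) :
    φ t ∈ P := by
  have : t = ∑ w ∈ t.coeff.support, t.coeff w • mon Q w := by
    conv_lhs => rw [← MonoidAlgebra.sum_coeff_single t]
    simp [Finsupp.sum, mon]
  rw [this, map_sum]
  refine P.sum_mem fun w hw => ?_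
  rw [map_smul]
  exact P.smul_mem _ (h w (ht w (by simpa using hw)))

theorem eq_of_supported {X : Set (FreeMonoid S)} {φ ψ : Tens Q S →ₗ[Q] N}
    (h : ∀ w ∈ X, φ (mon Q w) = ψ (mon Q w)) {t : Tens Q S}
    (ht : ∀ w, t.coeff w ≠ 0 → w ∈ X) : φ t = ψ t := by
  have := mem_of_supported (φ := φ - ψ) (P := ⊥) (X := X)
    (fun w hw => by simpa [sub_eq_zero] using h w hw) ht
  simpa [sub_eq_zero] using this

end

variable (D : S → ℕ)

/-- The degree of a word. -/
def wdeg (w : FreeMonoid S) : ℕ := (w.toList.map D).sum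

@[simp] theorem wdeg_one : wdeg D (1 : FreeMonoid S) = 0 := rfl

@[simp] theorem wdeg_of (s : S) : wdeg D (FreeMonoid.of s) = D s := by simp [wdeg]

@[simp] theorem wdeg_mul (w w' : FreeMonoid S) : wdeg D (w * w') = wdeg D w + wdeg D w' := by
  simp [wdeg]

/-- Homogeneous polynomials of degree `n` in words of length at least `l`. -/
noncomputable def homog (Q : Type*) [CommRing Q] (l n : ℕ) : Submodule Q (Tens Q S) :=
  MonoidAlgebra.supported Q Q {w | l ≤ w.length ∧ wdeg D w = n}

theorem mem_homog {l n : ℕ} {t : Tens Q S} :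
    t ∈ homog D Q l n ↔ ∀ w, t.coeff w ≠ 0 → l ≤ w.length ∧ wdeg D w = n := by
  rw [homog, MonoidAlgebra.mem_supported']
  exact forall_congr' fun w => not_imp_comm

theorem mon_mem_homog {l n : ℕ} {w : FreeMonoid S} (h : l ≤ w.length) (h' : wdeg D w = n) :
    mon Q w ∈ homog D Q l n := by
  rw [mem_homog]
  intro v hv
  have : v = w := by
    by_contra hne
    exact hv (by simp [mon, Ne.symm hne])
  subst this
  exact ⟨h, h'⟩

theorem letter_mem_homog (s : S) : letter Q s ∈ homog D Q 1 (D s) :=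
  mon_mem_homog D (by simp) (by simp)

theorem homog_mono {l l' n : ℕ} (h : l' ≤ l) : homog D Q (S := S) l n ≤ homog D Q l' n :=
  fun _ ht => (mem_homog D).2 fun w hw => ⟨h.trans ((mem_homog D).1 ht w hw).1,
    ((mem_homog D).1 ht w hw).2⟩

theorem mul_mem_homog {l n l' n' : ℕ} {a b : Tens Q S} (ha : a ∈ homog D Q l n)
    (hb : b ∈ homog D Q l' n') : a * b ∈ homog D Q (l + l') (n + n') := by
  refine mem_of_supported (φ := LinearMap.mulRight Q b) (fun w hw => ?_) ((mem_homog D).1 ha)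
  refine mem_of_supported (φ := LinearMap.mulLeft Q (mon Q w)) (fun w' hw' => ?_)
    ((mem_homog D).1 hb)
  rw [LinearMap.mulLeft_apply, ← mon_mul]
  refine mon_mem_homog D ?_ ?_
  · simpa using add_le_add hw.1 hw'.1
  · rw [wdeg_mul, hw.2, hw'.2]

/-- The sign automorphism, multiplying a word of degree `n` by `(-1) ^ n`. -/
noncomputable def sgn : Tens Q S →ₗ[Q] Tens Q S := extend fun w => (-1 : Q) ^ wdeg D w • mon Q w

theorem sgn_mon (w : FreeMonoid S) : sgn D (mon Q w) = (-1 : Q) ^ wdeg D w • mon Q w :=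
  extend_mon _ _

theorem sgn_eq {l n : ℕ} {t : Tens Q S} (ht : t ∈ homog D Q l n) : sgn D t = (-1 : Q) ^ n • t := by
  refine eq_of_supported (ψ := (-1 : Q) ^ n • LinearMap.id) (fun w hw => ?_) ((mem_homog D).1 ht)
  simp [sgn_mon, hw.2]

theorem sgn_mem {l n : ℕ} {t : Tens Q S} (ht : t ∈ homog D Q l n) : sgn D t ∈ homog D Q l n := by
  rw [sgn_eq D ht]
  exact Submodule.smul_mem _ _ ht

theorem sgn_mul (a b : Tens Q S) : sgn D (a * b) = sgn D a * sgn D b := by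
  suffices h : (sgn D ∘ₗ LinearMap.mulRight Q b) =
      (LinearMap.mulRight Q (sgn D b) ∘ₗ sgn D (Q := Q)) from LinearMap.congr_fun h a
  refine linearMap_ext fun w => ?_
  suffices h : (sgn D ∘ₗ LinearMap.mulLeft Q (mon Q w)) =
      (LinearMap.mulLeft Q (sgn D (mon Q w)) ∘ₗ sgn D (Q := Q)) from LinearMap.congr_fun h b
  refine linearMap_ext fun w' => ?_
  simp [sgn_mon, ← mon_mul, pow_add, smul_smul, mul_comm]

theorem sgn_sgn (a : Tens Q S) : sgn D (sgn D a) = a := by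
  suffices h : (sgn D ∘ₗ sgn D (Q := Q) (S := S)) = LinearMap.id from LinearMap.congr_fun h a
  refine linearMap_ext fun w => ?_
  simp [sgn_mon, smul_smul, ← mul_pow]

theorem sgn_one : sgn D (1 : Tens Q S) = 1 := by
  rw [← mon_one, sgn_mon]; simp

variable (f : S → Tens Q S)

/-- The value on a word of the signed derivation with value `f s` on the letter `s`. -/
noncomputable def derivWord : List S → Tens Q S
  | [] => 0
  | s :: p => f s * mon Q (FreeMonoid.ofList p) + (-1 : Q) ^ D s • (letter Q s * derivWord p)

/-- The signed derivation with value `f s` on the letter `s`. -/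
noncomputable def deriv : Tens Q S →ₗ[Q] Tens Q S := extend fun w => derivWord D f w.toList

theorem deriv_one : deriv D f 1 = 0 := by
  rw [← mon_one, deriv, extend_mon]; rfl

theorem deriv_of_mul (s : S) (w : FreeMonoid S) : deriv D f (mon Q (FreeMonoid.of s * w)) =
    f s * mon Q w + (-1 : Q) ^ D s • (letter Q s * deriv D f (mon Q w)) := by
  rw [deriv, extend_mon, extend_mon]; rfl

theorem deriv_letter (s : S) : deriv D f (letter Q s) = f s := by
  have := deriv_of_mul D f s 1
  rwa [mul_one, mon_one, deriv_one, mul_zero, smul_zero, add_zero, mul_one] at this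

/-- The signed Leibniz rule needs checking only on words, where it follows by induction on the
length of the first factor. -/
theorem deriv_mul (a b : Tens Q S) :
    deriv D f (a * b) = deriv D f a * b + sgn D a * deriv D f b := by
  suffices h : (deriv D f ∘ₗ LinearMap.mulRight Q b) = (LinearMap.mulRight Q b ∘ₗ deriv D f +
      LinearMap.mulRight Q (deriv D f b) ∘ₗ sgn D (Q := Q)) from LinearMap.congr_fun h a
  refine linearMap_ext fun w => ?_
  suffices h : (deriv D f ∘ₗ LinearMap.mulLeft Q (mon Q w)) =
      (LinearMap.mulLeft Q (deriv D f (mon Q w)) +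
      LinearMap.mulLeft Q (sgn D (mon Q w)) ∘ₗ deriv D f) from LinearMap.congr_fun h b
  refine linearMap_ext fun w' => ?_
  simp only [LinearMap.comp_apply, LinearMap.mulLeft_apply, LinearMap.add_apply]
  induction w using FreeMonoid.inductionOn' with
  | one => simp [mon_one, deriv_one, sgn_one]
  | of_mul s w ih =>
    rw [← mon_mul, mul_assoc, deriv_of_mul, deriv_of_mul, mon_mul w, ih, mon_mul (FreeMonoid.of s),
      sgn_mul, ← letter, sgn_eq D (letter_mem_homog D s)]
    simp only [mul_add, add_mul, smul_add, mul_assoc, smul_mul_assoc]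
    abel

variable {D f}

theorem deriv_mem_homog (hf : ∀ s, f s ∈ homog D Q 1 (D s + 1)) {l n : ℕ} {t : Tens Q S}
    (ht : t ∈ homog D Q l n) : deriv D f t ∈ homog D Q l (n + 1) := by
  refine mem_of_supported (fun w hw => ?_) ((mem_homog D).1 ht)
  suffices h : deriv D f (mon Q w) ∈ homog D Q w.length (wdeg D w + 1) by
    rw [← hw.2]; exact homog_mono D hw.1 h
  clear hw
  induction w using FreeMonoid.inductionOn' with
  | one => rw [mon_one, deriv_one]; exact Submodule.zero_mem _
  | of_mul s w ih =>
    rw [deriv_of_mul, FreeMonoid.length_mul, wdeg_mul, FreeMonoid.length_of, wdeg_of]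
    refine Submodule.add_mem _ ?_ (Submodule.smul_mem _ _ ?_)
    · rw [add_right_comm]
      exact mul_mem_homog D (hf s) (mon_mem_homog D le_rfl rfl)
    · rw [add_assoc]
      exact mul_mem_homog D (letter_mem_homog D s) ih

theorem sgn_deriv (hf : ∀ s, f s ∈ homog D Q 1 (D s + 1)) (t : Tens Q S) :
    sgn D (deriv D f t) = -deriv D f (sgn D t) := by
  suffices h : (sgn D ∘ₗ deriv D f) = - (deriv D f ∘ₗ sgn D (Q := Q)) from LinearMap.congr_fun h t
  refine linearMap_ext fun w => ?_
  have hw : mon Q w ∈ homog D Q 0 (wdeg D w) := mon_mem_homog D (Nat.zero_le _) rfl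
  simp only [LinearMap.comp_apply, LinearMap.neg_apply, sgn_eq D hw,
    sgn_eq D (deriv_mem_homog hf hw), map_smul, pow_succ]
  simp

/-- The square of an odd derivation is an ordinary derivation, and so is a commutator; hence they
agree on a word once they agree on its letters. Asking this only of the letters of `w` allows use
while the curvature equation is known in low degrees only. -/
theorem deriv_deriv_word (hf : ∀ s, f s ∈ homog D Q 1 (D s + 1)) {h : Tens Q S}
    {w : FreeMonoid S}
    (hw : ∀ s ∈ w.toList, deriv D f (f s) = h * letter Q s - letter Q s * h) :
    deriv D f (deriv D f (mon Q w)) = h * mon Q w - mon Q w * h := by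
  induction w using FreeMonoid.inductionOn' with
  | one => simp [mon_one, deriv_one]
  | of_mul s w ih =>
    have ih' := ih fun s' hs' => hw s' (by simp [hs'])
    have hs := hw s (by simp)
    rw [deriv_of_mul, map_add, map_smul, deriv_mul, deriv_mul, deriv_letter, ih', hs,
      sgn_eq D (hf s), sgn_eq D (letter_mem_homog D s), mon_mul, ← letter]
    rcases neg_one_pow_eq_or Q (D s) with h | h <;>
      simp only [pow_succ, h, mul_neg, mul_one, neg_mul, smul_add, neg_smul, one_smul,
        neg_neg] <;> noncomm_ring

theorem deriv_deriv (hf : ∀ s, f s ∈ homog D Q 1 (D s + 1)) {h t : Tens Q S}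
    (ht : ∀ w, t.coeff w ≠ 0 →
      ∀ s ∈ w.toList, deriv D f (f s) = h * letter Q s - letter Q s * h) :
    deriv D f (deriv D f t) = h * t - t * h :=
  eq_of_supported (φ := deriv D f ∘ₗ deriv D f)
    (ψ := LinearMap.mulLeft Q h - LinearMap.mulRight Q h)
    (X := {w | ∀ s ∈ w.toList, deriv D f (f s) = h * letter Q s - letter Q s * h})
    (fun _ hw => deriv_deriv_word hf hw) ht

theorem deriv_congr {f' : S → Tens Q S} {t : Tens Q S}
    (ht : ∀ w, t.coeff w ≠ 0 → ∀ s ∈ w.toList, f s = f' s) : deriv D f t = deriv D f' t := by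
  refine eq_of_supported (X := {w | ∀ s ∈ w.toList, f s = f' s}) (fun w hw => ?_) ht
  induction w using FreeMonoid.inductionOn' with
  | one => simp [mon_one, deriv_one]
  | of_mul s w ih =>
    rw [deriv_of_mul, deriv_of_mul, ih fun s' hs' => hw s' (by simp [hs']), hw s (by simp)]

theorem D_le_wdeg {w : FreeMonoid S} {s : S} (hs : s ∈ w.toList) : D s ≤ wdeg D w :=
  List.le_sum_of_mem (List.mem_map_of_mem hs)

/-- Any other letter contributes at least 2. Thus the nonlinear part of `f s`, of degree `D s + 1`,
involves only letters of degree below `D s`; this makes the later constructions inductive. -/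
theorem D_add_two_le_wdeg (hD : ∀ s, 2 ≤ D s) {w : FreeMonoid S} (hw : 2 ≤ w.length) {s : S}
    (hs : s ∈ w.toList) : D s + 2 ≤ wdeg D w := by
  induction w using FreeMonoid.inductionOn' with
  | one => simp at hs
  | of_mul s' w ih =>
    rw [FreeMonoid.length_mul, FreeMonoid.length_of] at hw
    rw [wdeg_mul, wdeg_of]
    rcases List.mem_cons.1 hs with rfl | hs
    · obtain ⟨s, hs⟩ : ∃ s, s ∈ w.toList :=
        List.exists_mem_of_length_pos (show 0 < w.length by omega)
      have := D_le_wdeg (D := D) hs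
      have := hD s
      omega
    · have := D_le_wdeg (D := D) hs
      have := hD s'
      omega

theorem homog_two_three (hD : ∀ s, 2 ≤ D s) {t : Tens Q S} (ht : t ∈ homog D Q 2 3) : t = 0 := by
  refine MonoidAlgebra.ext (Finsupp.ext fun w => ?_)
  by_contra hw
  obtain ⟨h1, h2⟩ := (mem_homog D).1 ht w hw
  obtain ⟨s, hs⟩ : ∃ s, s ∈ w.toList :=
    List.exists_mem_of_length_pos (show 0 < w.length by omega)
  have := D_add_two_le_wdeg hD h1 hs
  have := hD s
  omega

end TensorAlgebra


/-! ### The curved differential attached to a resolution of a cyclic algebra. -/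

section CurvedAlgebra

variable {Q : Type*} [CommRing Q] {S : Type*}

/-- The tensor algebra is free over `Q` on words, so exactness over `Q` applies to each coefficient
separately. The set `X` carries the support conditions on words over to the lift. -/
theorem exists_coeffwise_lift {ι : Type*} [Fintype ι] {dg : ι → ℕ} {d : ι → ι → Q}
    {C : (ι → Q) → Prop} {m : ℕ}
    (hexact : ∀ v : ι → Q, (∀ i, v i ≠ 0 → dg i = m) → C v →
      ∃ w : ι → Q, (∀ i, w i ≠ 0 → dg i = m + 1) ∧ ∀ j, ∑ i, w i * d i j = v j)
    {z : ι → Tens Q S} (hz : ∀ i, dg i ≠ m → z i = 0) {X : Set (FreeMonoid S)}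
    (hX : ∀ i w, (z i).coeff w ≠ 0 → w ∈ X) (hC : ∀ w ∈ X, C fun i => (z i).coeff w) :
    ∃ y : ι → Tens Q S, (∀ i, dg i ≠ m + 1 → y i = 0) ∧
      (∀ i w, (y i).coeff w ≠ 0 → w ∈ X) ∧ ∀ j, ∑ i, d i j • y i = z j := by
  classical
  have key : ∀ w : FreeMonoid S, ∃ v : ι → Q, (∀ i, v i ≠ 0 → dg i = m + 1) ∧
      ∀ j, w ∈ X → ∑ i, v i * d i j = (z j).coeff w := by
    intro w
    by_cases hw : w ∈ X
    · obtain ⟨v, h1, h2⟩ := hexact (fun i => (z i).coeff w)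
        (fun i hi => by
          by_contra h
          rw [hz i h] at hi
          exact hi rfl) (hC w hw)
      exact ⟨v, h1, fun j _ => h2 j⟩
    · exact ⟨0, by simp, fun j h => absurd h hw⟩
  choose v hv1 hv2 using key
  let F : Finset (FreeMonoid S) := Finset.univ.biUnion fun i => (z i).coeff.support
  have hF : ∀ i w, w ∉ F → (z i).coeff w = 0 := by
    intro i w hw
    by_contra h
    exact hw (Finset.mem_biUnion.2 ⟨i, Finset.mem_univ _, by simpa using h⟩)
  have hFX : ∀ w ∈ F, w ∈ X := by
    intro w hw
    obtain ⟨i, -, hi⟩ := Finset.mem_biUnion.1 hw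
    exact hX i w (by simpa using hi)
  let y : ι → Tens Q S := fun i => ∑ w ∈ F, v w i • mon Q w
  have hy : ∀ i w, (y i).coeff w = if w ∈ F then v w i else 0 := by
    intro i w
    simp [y, mon, Finsupp.single_apply, Finsupp.finsetSum_apply]
  refine ⟨y, fun i hi => ?_, fun i w hw => ?_, fun j => ?_⟩
  · refine Finset.sum_eq_zero fun w _ => ?_
    have : v w i = 0 := by
      by_contra h
      exact hi (hv1 w i h)
    rw [this, zero_smul]
  · rw [hy] at hw
    by_contra h
    exact hw (if_neg fun h' => h (hFX w h'))
  · refine MonoidAlgebra.ext (Finsupp.ext fun w => ?_)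
    rw [MonoidAlgebra.coeff_sum, Finsupp.finsetSum_apply]
    simp only [MonoidAlgebra.coeff_smul_apply, hy, smul_eq_mul]
    by_cases hw : w ∈ F
    · simp only [hw, if_true]
      rw [← hv2 w j (hFX w hw)]
      exact Finset.sum_congr rfl fun i _ => mul_comm _ _
    · simp [hw, hF j w hw]

variable [Fintype S]

/-- The letters `S`, of degree one more than their homological degree, are a basis of the positive
part of a finite free resolution of `Q` modulo an ideal: the differential of `s` is
`∑ s', d s s' • s' + h s`, where `h s ∈ Q` is the component in degree zero. -/
structure IsCyclicResolution (D : S → ℕ) (d : S → S → Q) (h : S → Q) : Prop where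
  two_le : ∀ s, 2 ≤ D s
  d_deg : ∀ s s', d s s' ≠ 0 → D s = D s' + 1
  h_deg : ∀ s, h s ≠ 0 → D s = 2
  d_d : ∀ s s'', ∑ s', d s s' * d s' s'' = 0
  d_h : ∀ s, ∑ s', d s s' * h s' = 0
  exact : ∀ (m : ℕ) (v : S → Q), (∀ s, v s ≠ 0 → D s = m) →
    ((∀ s', ∑ s, v s * d s s' = 0) ∧ ∑ s, v s * h s = 0) →
    ∃ w : S → Q, (∀ s, w s ≠ 0 → D s = m + 1) ∧ ∀ s', ∑ s, w s * d s s' = v s'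

/-- The linear polynomial with coefficients `h`. -/
noncomputable def linear (h : S → Q) : Tens Q S := ∑ s, h s • letter Q s

/-- A curved differential on the tensor algebra, with the curvature equation known in degrees
less than `m`. -/
structure IsCurved (D : S → ℕ) (d : S → S → Q) (h : S → Q) (m : ℕ) (f : S → Tens Q S) : Prop where
  mem : ∀ s, f s ∈ homog D Q 1 (D s + 1)
  lin : ∀ s, f s - linear (fun s' => d s' s) ∈ homog D Q 2 (D s + 1)
  rel : ∀ s, D s < m → deriv D f (f s) = linear h * letter Q s - letter Q s * linear h

variable {D : S → ℕ} {d : S → S → Q} {h : S → Q}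

theorem linear_mem {v : S → Q} {n : ℕ} (hv : ∀ s, v s ≠ 0 → D s = n) :
    linear v ∈ homog D Q 1 n := by
  refine Submodule.sum_mem _ fun s _ => ?_
  by_cases hs : v s = 0
  · rw [hs, zero_smul]; exact Submodule.zero_mem _
  · rw [← hv s hs]
    exact Submodule.smul_mem _ _ (letter_mem_homog D s)

theorem map_linear {N : Type*} [AddCommGroup N] [Module Q N] (φ : Tens Q S →ₗ[Q] N) (v : S → Q) :
    φ (linear v) = ∑ s, v s • φ (letter Q s) := by
  simp [linear]

namespace IsCyclicResolution

variable (hA : IsCyclicResolution D d h)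
include hA

theorem h_mem : linear h ∈ homog D Q 1 2 := linear_mem hA.h_deg

theorem sgn_h : sgn D (linear h) = linear h := by
  rw [sgn_eq D hA.h_mem]; simp

/-- Letters in the support of `h` have degree 2, and there is no word of length two in degree 3, so
`f` is linear on them. The identity is then `d_h`. -/
theorem deriv_h {f : S → Tens Q S}
    (hf : ∀ s, f s - linear (fun s' => d s' s) ∈ homog D Q 2 (D s + 1)) :
    deriv D f (linear h) = 0 := by
  rw [map_linear]
  have h1 : ∀ s, h s • deriv D f (letter Q s) = h s • linear (fun s' => d s' s) := by
    intro s
    by_cases hs : h s = 0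
    · simp [hs]
    · have := hf s
      rw [hA.h_deg s hs] at this
      rw [deriv_letter, ← sub_eq_zero, ← smul_sub, homog_two_three hA.two_le this, smul_zero]
  simp only [h1, linear, Finset.smul_sum, smul_smul]
  rw [Finset.sum_comm]
  refine Finset.sum_eq_zero fun s' _ => ?_
  rw [← Finset.sum_smul]
  have := hA.d_h s'
  simp only [mul_comm (h _), this, zero_smul]

/-- The curvature defect is a coefficientwise cycle. -/
theorem defect_cycle {m : ℕ} {f : S → Tens Q S} (hf : IsCurved D d h m f) {s : S} (hs : D s < m) :
    ∑ s', d s' s • (linear h * letter Q s' - letter Q s' * linear h - deriv D f (f s')) = 0 := by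
  have hfh := hA.deriv_h hf.lin
  -- `K` is the commutator with `h` minus the square of the derivation. It kills `f s` by the known
  -- relation for `s`, and kills the nonlinear part of `f s` because its letters have smaller
  -- degree; hence it kills the linear part, which is the claim.
  let K : Tens Q S →ₗ[Q] Tens Q S :=
    LinearMap.mulLeft Q (linear h) - LinearMap.mulRight Q (linear h) - deriv D f ∘ₗ deriv D f
  have hK : ∀ t, K t = linear h * t - t * linear h - deriv D f (deriv D f t) := fun t => rfl
  have h1 : K (f s) = 0 := by
    rw [hK, hf.rel s hs, map_sub, deriv_mul, deriv_mul, hfh, deriv_letter, hA.sgn_h]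
    simp
  have h2 : K (f s - linear (fun s' => d s' s)) = 0 := by
    rw [hK, sub_eq_zero]
    refine (deriv_deriv hf.mem fun w hw s' hs' => hf.rel s' ?_).symm
    obtain ⟨h3, h4⟩ := (mem_homog D).1 (hf.lin s) w hw
    have := D_add_two_le_wdeg hA.two_le h3 hs'
    omega
  rw [map_sub, h1, zero_sub, neg_eq_zero, map_linear] at h2
  simpa only [hK, deriv_letter] using h2

/-- This is the same operator evaluated on `h` itself, which commutes with itself and has derivative
zero. It gives the cycle condition at the augmentation end. -/
theorem defect_cycle_h {m : ℕ} {f : S → Tens Q S} (hf : IsCurved D d h m f) :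
    ∑ s, h s • (linear h * letter Q s - letter Q s * linear h - deriv D f (f s)) = 0 := by
  let K : Tens Q S →ₗ[Q] Tens Q S :=
    LinearMap.mulLeft Q (linear h) - LinearMap.mulRight Q (linear h) - deriv D f ∘ₗ deriv D f
  have hK : ∀ t, K t = linear h * t - t * linear h - deriv D f (deriv D f t) := fun t => rfl
  have h1 : K (linear h) = 0 := by
    rw [hK, hA.deriv_h hf.lin]; simp
  rw [map_linear] at h1
  simpa only [hK, deriv_letter] using h1

/-- The commutator is quadratic, and the linear part of the square of the derivation is the
transpose of `d ∘ d = 0`. -/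
theorem defect_mem {m : ℕ} {f : S → Tens Q S} (hf : IsCurved D d h m f) (s : S) :
    linear h * letter Q s - letter Q s * linear h - deriv D f (f s) ∈ homog D Q 2 (D s + 2) := by
  refine Submodule.sub_mem _ (Submodule.sub_mem _ ?_ ?_) ?_
  · have := mul_mem_homog D hA.h_mem (letter_mem_homog (Q := Q) D s)
    rwa [add_comm 2 (D s)] at this
  · exact mul_mem_homog D (letter_mem_homog D s) hA.h_mem
  · have h1 : f s = (f s - linear (fun s' => d s' s)) + linear (fun s' => d s' s) := by abel
    rw [h1, map_add]
    refine Submodule.add_mem _ (deriv_mem_homog hf.mem (hf.lin s)) ?_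
    rw [map_linear]
    have h2 : ∑ s', d s' s • deriv D f (letter Q s') =
        ∑ s', d s' s • (f s' - linear (fun s'' => d s'' s')) +
          ∑ s', d s' s • linear (fun s'' => d s'' s') := by
      simp [deriv_letter, smul_sub]
    have h3 : ∑ s', d s' s • linear (fun s'' => d s'' s') = 0 := by
      simp only [linear, Finset.smul_sum, smul_smul]
      rw [Finset.sum_comm]
      refine Finset.sum_eq_zero fun s'' _ => ?_
      rw [← Finset.sum_smul]
      simp only [mul_comm (d _ s), hA.d_d, zero_smul]
    rw [h2, h3, add_zero]
    refine Submodule.sum_mem _ fun s' _ => ?_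
    by_cases hs : d s' s = 0
    · rw [hs, zero_smul]; exact Submodule.zero_mem _
    · have := hf.lin s'
      rw [hA.d_deg s' s hs] at this
      exact Submodule.smul_mem _ _ this

/-- The defect `z` in degree `m` is a cycle coefficientwise, hence the boundary of some `y` in
degree `m + 1`. Adding `y` to `f` cancels the defect and leaves `f` unchanged on letters of degree
at most `m`. -/
theorem curved_step {m : ℕ} {f : S → Tens Q S} (hf : IsCurved D d h m f) :
    ∃ f', IsCurved D d h (m + 1) f' := by
  classical
  let z : S → Tens Q S := fun s => if D s = m then
    linear h * letter Q s - letter Q s * linear h - deriv D f (f s) else 0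
  have hz : ∀ s, z s ∈ homog D Q 2 (m + 2) := by
    intro s
    by_cases hs : D s = m
    · simp only [z, hs, if_true]
      rw [← hs]; exact hA.defect_mem hf s
    · simp only [z, hs, if_false]; exact Submodule.zero_mem _
  have hz1 : ∀ s', ∑ s, d s s' • z s = 0 := by
    intro s'
    by_cases hs' : D s' < m
    · refine Eq.trans ?_ (hA.defect_cycle hf hs')
      refine Finset.sum_congr rfl fun s _ => ?_
      by_cases hs : d s s' = 0
      · simp [hs]
      · by_cases hm : D s = m
        · simp [z, hm]
        · have := hA.d_deg s s' hs
          simp [z, hm, hf.rel s (by omega)]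
    · refine Finset.sum_eq_zero fun s _ => ?_
      by_cases hs : d s s' = 0
      · simp [hs]
      · have := hA.d_deg s s' hs
        simp [z, show D s ≠ m by omega]
  -- Only `m = 2` has content, since `h` is supported on letters of degree 2.
  have hz2 : ∑ s, h s • z s = 0 := by
    by_cases hm : m = 2
    · refine Eq.trans ?_ (hA.defect_cycle_h hf)
      refine Finset.sum_congr rfl fun s _ => ?_
      by_cases hs : h s = 0
      · simp [hs]
      · simp [z, hm, hA.h_deg s hs]
    · refine Finset.sum_eq_zero fun s _ => ?_
      by_cases hs : h s = 0
      · simp [hs]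
      · simp [z, hA.h_deg s hs, Ne.symm hm]
  have hcoeff : ∀ (c : S → Q), ∑ s, c s • z s = 0 →
      ∀ w, ∑ s, (z s).coeff w * c s = 0 := by
    intro c hc w
    have := congrArg (fun t : Tens Q S => t.coeff w) hc
    simpa [Finsupp.finsetSum_apply, mul_comm] using this
  obtain ⟨y, hy1, hy2, hy3⟩ := exists_coeffwise_lift (hA.exact m) (z := z)
    (fun s hs => by simp [z, hs]) (X := {w | 2 ≤ w.length ∧ wdeg D w = m + 2})
    (fun s => (mem_homog D).1 (hz s))
    (fun w _ => ⟨fun s' => hcoeff _ (hz1 s') w, hcoeff _ hz2 w⟩)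
  have hy : ∀ s, y s ∈ homog D Q 2 (D s + 1) := by
    intro s
    by_cases hs : D s = m + 1
    · rw [hs]; exact (mem_homog D).2 (hy2 s)
    · rw [hy1 s hs]; exact Submodule.zero_mem _
  have hmem : ∀ s, f s + y s ∈ homog D Q 1 (D s + 1) := fun s =>
    Submodule.add_mem _ (hf.mem s) (homog_mono D one_le_two (hy s))
  have hlow : ∀ s, D s ≤ m → y s = 0 := fun s hs => hy1 s (by omega)
  refine ⟨fun s => f s + y s, hmem, fun s => ?_, fun s hs => ?_⟩
  · rw [add_sub_right_comm]
    exact Submodule.add_mem _ (hf.lin s) (hy s)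
  · have hsplit : ∀ t : Tens Q S, f s = (f s - t) + t := fun t => by abel
    -- Here `D s ≤ m`, so `f s` itself is unchanged and its nonlinear words use letters where `y`
    -- vanishes. Only the linear part feels the correction.
    have h1 : deriv D (fun s => f s + y s) (f s + y s) =
        deriv D f (f s) + ∑ s', d s' s • y s' := by
      rw [hlow s (by omega), add_zero, hsplit (linear fun s' => d s' s), map_add, map_add,
        add_assoc]
      congr 1
      · refine (deriv_congr fun w hw s' hs' => ?_).symm
        obtain ⟨h3, h4⟩ := (mem_homog D).1 (hf.lin s) w hw
        have := D_add_two_le_wdeg hA.two_le h3 hs'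
        rw [hlow s' (by omega), add_zero]
      · simp [map_linear, deriv_letter, smul_add, Finset.sum_add_distrib]
    rw [h1, hy3]
    by_cases hm : D s = m
    · simp [z, hm]
    · simp [z, hm, hf.rel s (by omega)]

theorem exists_curved : ∃ f : S → Tens Q S, (∀ s, f s ∈ homog D Q 1 (D s + 1)) ∧
    (∀ s, f s - linear (fun s' => d s' s) ∈ homog D Q 2 (D s + 1)) ∧
    ∀ s, deriv D f (f s) = linear h * letter Q s - letter Q s * linear h := by
  have key : ∀ m, ∃ f, IsCurved D d h m f := by
    intro m
    induction m with
    | zero =>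
      refine ⟨fun s => linear fun s' => d s' s, fun s => linear_mem fun s' => hA.d_deg s' s,
        fun s => ?_, fun s hs => absurd hs (Nat.not_lt_zero _)⟩
      rw [sub_self]; exact Submodule.zero_mem _
    | succ m ih => exact hA.curved_step ih.choose_spec
  -- There are finitely many letters, so the relation is known for all of them after finitely many
  -- steps.
  obtain ⟨f, hf⟩ := key (Finset.univ.sup D + 1)
  exact ⟨f, hf.mem, hf.lin, fun s => hf.rel s
    (Nat.lt_succ_of_le (Finset.le_sup (f := D) (Finset.mem_univ s)))⟩

end IsCyclicResolution

end CurvedAlgebra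


/-! ### The connection attached to a resolution of the module. -/

section CurvedModule

variable {Q : Type*} [CommRing Q] {S : Type*}

theorem coeff_mon_one (w : FreeMonoid S) [Decidable (w = 1)] :
    (mon Q w).coeff 1 = if w = 1 then 1 else 0 := by
  split_ifs with hw <;> simp [mon, hw]

theorem coeff_mul_one (a b : Tens Q S) : (a * b).coeff 1 = a.coeff 1 * b.coeff 1 := by
  classical
  let ε : Tens Q S →ₗ[Q] Q := Finsupp.lapply 1 ∘ₗ (MonoidAlgebra.coeffLinearEquiv Q).toLinearMap
  have hε : ∀ t : Tens Q S, ε t = t.coeff 1 := fun _ => rfl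
  suffices h : (ε ∘ₗ LinearMap.mulRight Q b) =
      (LinearMap.mulRight Q (ε b) ∘ₗ ε) from LinearMap.congr_fun h a
  refine linearMap_ext fun w => ?_
  suffices h : (ε ∘ₗ LinearMap.mulLeft Q (mon Q w)) =
      (LinearMap.mulLeft Q (ε (mon Q w)) ∘ₗ ε) from LinearMap.congr_fun h b
  refine linearMap_ext fun w' => ?_
  have : w * w' = 1 ↔ w = 1 ∧ w' = 1 := List.append_eq_nil_iff
  simp only [LinearMap.comp_apply, LinearMap.mulLeft_apply, hε,
    ← mon_mul, coeff_mon_one, this, ite_and]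
  split_ifs <;> simp

variable (D : S → ℕ)

theorem coeff_sgn_one (t : Tens Q S) : (sgn D t).coeff 1 = t.coeff 1 := by
  classical
  let ε : Tens Q S →ₗ[Q] Q := Finsupp.lapply 1 ∘ₗ (MonoidAlgebra.coeffLinearEquiv Q).toLinearMap
  have hε : ∀ t : Tens Q S, ε t = t.coeff 1 := fun _ => rfl
  suffices h : (ε ∘ₗ sgn D) = ε from LinearMap.congr_fun h t
  refine linearMap_ext fun w => ?_
  simp only [LinearMap.comp_apply, sgn_mon, hε, MonoidAlgebra.coeff_smul_apply, coeff_mon_one]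
  split_ifs with hw <;> simp [hw]

theorem coeff_deriv_one {f : S → Tens Q S} (hf : ∀ s, f s ∈ homog D Q 1 (D s + 1))
    (t : Tens Q S) : (deriv D f t).coeff 1 = 0 := by
  let ε : Tens Q S →ₗ[Q] Q := Finsupp.lapply 1 ∘ₗ (MonoidAlgebra.coeffLinearEquiv Q).toLinearMap
  suffices h : (ε ∘ₗ deriv D f) = 0 from LinearMap.congr_fun h t
  refine linearMap_ext fun w => ?_
  change (deriv D f (mon Q w)).coeff 1 = 0
  by_cases hw : w = 1
  · rw [hw, mon_one, deriv_one]; rfl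
  · by_contra h
    have h1 : mon Q w ∈ homog D Q 1 (wdeg D w) :=
      mon_mem_homog D (Nat.one_le_iff_ne_zero.2 (mt FreeMonoid.length_eq_zero.1 hw)) rfl
    have := ((mem_homog D).1 (deriv_mem_homog hf h1) 1 h).1
    simp at this

/-- An entry from `u` to `u'` has degree `dg u + 1 - dg u'`. Keeping the subtracted term on the left
avoids truncated subtraction. -/
theorem coeff_mul_deg {k l n : ℕ} {a b : Tens Q S}
    (ha : ∀ w, a.coeff w ≠ 0 → wdeg D w + k = n) (hb : ∀ w, b.coeff w ≠ 0 → wdeg D w + l = k + 1)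
    (w : FreeMonoid S) (hw : (a * b).coeff w ≠ 0) : wdeg D w + l = n + 1 := by
  let P : Submodule Q (Tens Q S) := MonoidAlgebra.supported Q Q {w | wdeg D w + l = n + 1}
  have hP : ∀ t, t ∈ P ↔ ∀ w, t.coeff w ≠ 0 → wdeg D w + l = n + 1 := by
    intro t
    rw [MonoidAlgebra.mem_supported']
    exact forall_congr' fun w => not_imp_comm
  refine (hP _).1 ?_ w hw
  refine mem_of_supported (φ := LinearMap.mulRight Q b) (fun w hw => ?_) ha
  refine mem_of_supported (φ := LinearMap.mulLeft Q (mon Q w)) (fun w' hw' => ?_) hb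
  rw [LinearMap.mulLeft_apply, ← mon_mul, hP]
  intro v hv
  have : v = w * w' := by
    by_contra hne
    exact hv (by simp [mon, Ne.symm hne])
  subst this
  have h1 : wdeg D w + k = n := hw
  have h2 : wdeg D w' + l = k + 1 := hw'
  rw [wdeg_mul]
  omega

variable {D}

theorem coeff_deriv_deg {f : S → Tens Q S} (hf : ∀ s, f s ∈ homog D Q 1 (D s + 1)) {k n : ℕ}
    {t : Tens Q S} (ht : ∀ w, t.coeff w ≠ 0 → wdeg D w + k = n) (w : FreeMonoid S)
    (hw : (deriv D f t).coeff w ≠ 0) : wdeg D w + k = n + 1 := by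
  by_cases hk : k ≤ n
  · have h1 : t ∈ homog D Q 0 (n - k) :=
      (mem_homog D).2 fun w hw => ⟨Nat.zero_le _, by have := ht w hw; omega⟩
    have := ((mem_homog D).1 (deriv_mem_homog hf h1) w hw).2
    omega
  · have : t = 0 := by
      refine MonoidAlgebra.ext (Finsupp.ext fun w => ?_)
      by_contra h
      have := ht w h
      omega
    rw [this, map_zero] at hw
    exact absurd rfl hw

theorem eq_smul_one_of_coeff {t : Tens Q S} (ht : ∀ w, t.coeff w ≠ 0 → w = 1) :
    t = t.coeff 1 • 1 := by
  classical
  refine MonoidAlgebra.ext (Finsupp.ext fun w => ?_)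
  rw [MonoidAlgebra.coeff_smul_apply, ← mon_one]
  by_cases hw : w = 1
  · subst hw; simp [coeff_mon_one]
  · have : t.coeff w = 0 := by
      by_contra h
      exact hw (ht w h)
    simp [this, mon, Ne.symm hw]

theorem eq_one_of_wdeg_le_one (hD : ∀ s, 2 ≤ D s) {w : FreeMonoid S} (hw : wdeg D w ≤ 1) :
    w = 1 := by
  induction w using FreeMonoid.inductionOn' with
  | one => rfl
  | of_mul s w _ =>
    rw [wdeg_mul, wdeg_of] at hw
    have := hD s
    omega

variable {U : Type*} [Fintype U]

/-- `U` is a basis of a finite free resolution of the module `N`, with differential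
`u ↦ ∑ u', e u u' • u'` and augmentation `gen`. -/
structure IsModuleResolution {N : Type*} [AddCommGroup N] [Module Q N] (dg : U → ℕ)
    (e : U → U → Q) (gen : U → N) : Prop where
  d_deg : ∀ u u', e u u' ≠ 0 → dg u = dg u' + 1
  gen_deg : ∀ u, gen u ≠ 0 → dg u = 0
  d_d : ∀ u u'', ∑ u', e u u' * e u' u'' = 0
  d_gen : ∀ u, ∑ u', e u u' • gen u' = 0
  exact : ∀ (m : ℕ) (v : U → Q), (∀ u, v u ≠ 0 → dg u = m) →
    ((∀ u', ∑ u, v u * e u u' = 0) ∧ ∑ u, v u • gen u = 0) →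
    ∃ w : U → Q, (∀ u, w u ≠ 0 → dg u = m + 1) ∧ ∀ u', ∑ u, w u * e u u' = v u'

/-- The defect of the curvature equation for the connection matrix `g`. -/
noncomputable def defect [DecidableEq U] (D : S → ℕ) (f : S → Tens Q S) (H : Tens Q S)
    (g : Matrix U U (Tens Q S)) : Matrix U U (Tens Q S) :=
  Matrix.diagonal (fun _ => H) - g.map (deriv D f) - g.map (sgn D) * g

theorem defect_apply [DecidableEq U] (D : S → ℕ) (f : S → Tens Q S) (H : Tens Q S)
    (g : Matrix U U (Tens Q S))
    (u v : U) : defect D f H g u v =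
      (if u = v then H else 0) - deriv D f (g u v) - ∑ u', sgn D (g u u') * g u' v := by
  simp [defect, Matrix.mul_apply, Matrix.diagonal_apply]

theorem map_deriv_mul (f : S → Tens Q S) (a b : Matrix U U (Tens Q S)) :
    (a * b).map (deriv D f) = a.map (deriv D f) * b + a.map (sgn D) * b.map (deriv D f) := by
  ext i j : 1
  simp [Matrix.mul_apply, deriv_mul, Finset.sum_add_distrib]

theorem map_sgn_mul (a b : Matrix U U (Tens Q S)) :
    (a * b).map (sgn D) = a.map (sgn D) * b.map (sgn D) := by
  ext i j : 1
  simp [Matrix.mul_apply, sgn_mul]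

/-- The Bianchi identity: differentiating the defect, the terms cancel because the derivation
squares to the commutator with `H` and annihilates `H`. It is what makes the defect of the
connection a cycle. -/
theorem bianchi [DecidableEq U] {f : S → Tens Q S} {H : Tens Q S}
    (hf : ∀ s, f s ∈ homog D Q 1 (D s + 1))
    (hrel : ∀ s, deriv D f (f s) = H * letter Q s - letter Q s * H) (hH : deriv D f H = 0)
    (hH' : sgn D H = H) (g : Matrix U U (Tens Q S)) :
    g * defect D f H g = (defect D f H g).map (deriv D f) + (defect D f H g).map (sgn D) * g := by
  have hdd : (g.map (deriv D f)).map (deriv D f) =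
      Matrix.diagonal (fun _ => H) * g - g * Matrix.diagonal (fun _ => H) := by
    ext i j : 1
    simp [deriv_deriv hf (h := H) (t := g i j) fun w _ s _ => hrel s]
  have hds : (g.map (sgn D)).map (deriv D f) = - (g.map (deriv D f)).map (sgn D) := by
    ext i j : 1
    simp [sgn_deriv hf]
  have hss : (g.map (sgn D)).map (sgn D) = g := by
    ext i j : 1
    simp [sgn_sgn]
  have hH1 : (Matrix.diagonal (fun _ : U => H)).map (deriv D f) = 0 := by
    ext i j : 1
    by_cases hij : i = j <;> simp [hij, hH]
  have hH2 : (Matrix.diagonal (fun _ : U => H)).map (sgn D) = Matrix.diagonal (fun _ : U => H) := by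
    ext i j : 1
    by_cases hij : i = j <;> simp [hij, hH']
  have hsub : ∀ (φ : Tens Q S →ₗ[Q] Tens Q S) (a b : Matrix U U (Tens Q S)),
      (a - b).map φ = a.map φ - b.map φ := by
    intro φ a b
    ext i j : 1
    simp
  simp only [defect, hsub, map_deriv_mul, map_sgn_mul, hdd, hds, hss, hH1, hH2]
  noncomm_ring

/-- A connection matrix, with the curvature equation known in degrees less than `m`. -/
structure IsConnection [DecidableEq U] (D : S → ℕ) (f : S → Tens Q S) (H : Tens Q S) (dg : U → ℕ)
    (e : U → U → Q) (m : ℕ) (g : Matrix U U (Tens Q S)) : Prop where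
  mem : ∀ u u' w, (g u u').coeff w ≠ 0 → wdeg D w + dg u' = dg u + 1
  lin : ∀ u u', (g u u').coeff 1 = e u' u
  rel : ∀ u, dg u < m → ∀ v, defect D f H g u v = 0

section

variable [Fintype S] [DecidableEq U] {d : S → S → Q} {h : S → Q} {f : S → Tens Q S} {dg : U → ℕ}
  {e : U → U → Q}
  {N : Type*} [AddCommGroup N] [Module Q N] {gen : U → N}

/-- The words in such an entry have degree at most 1, while every letter has degree at least 2, so
only the empty word remains. -/
theorem IsConnection.eq_smul_one (hA : IsCyclicResolution D d h) {m : ℕ} {H : Tens Q S}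
    {g : Matrix U U (Tens Q S)} (hg : IsConnection D f H dg e m g) {u u' : U}
    (h' : dg u ≤ dg u') : g u u' = e u' u • 1 := by
  rw [← hg.lin]
  refine eq_smul_one_of_coeff fun w hw => eq_one_of_wdeg_le_one hA.two_le ?_
  have := hg.mem u u' w hw
  omega

/-- As in `curved_step`, the defect in rows of degree `m` is a coefficientwise cycle and gets killed
by a correction in rows of degree `m + 1`. That `h` annihilates the module is needed at the
augmentation end. -/
theorem connection_step (hA : IsCyclicResolution D d h)
    (hf : ∀ s, f s ∈ homog D Q 1 (D s + 1))
    (hf' : ∀ s, f s - linear (fun s' => d s' s) ∈ homog D Q 2 (D s + 1))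
    (hrel : ∀ s, deriv D f (f s) = linear h * letter Q s - letter Q s * linear h)
    (hG : IsModuleResolution dg e gen) (hN : ∀ s (n : N), h s • n = 0) {m : ℕ}
    {g : Matrix U U (Tens Q S)} (hg : IsConnection D f (linear h) dg e m g) :
    ∃ g', IsConnection D f (linear h) dg e (m + 1) g' := by
  let z : U → U → Tens Q S := fun v u => if dg u = m then defect D f (linear h) g u v else 0
  have hsg : ∀ u u' w, (sgn D (g u u')).coeff w ≠ 0 → wdeg D w + dg u' = dg u + 1 := by
    intro u u' w hw
    let P : Submodule Q (Tens Q S) :=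
      MonoidAlgebra.supported Q Q {w | wdeg D w + dg u' = dg u + 1}
    have hP : ∀ t, t ∈ P ↔ ∀ w, t.coeff w ≠ 0 → wdeg D w + dg u' = dg u + 1 := by
      intro t
      rw [MonoidAlgebra.mem_supported']
      exact forall_congr' fun w => not_imp_comm
    refine (hP _).1 (mem_of_supported (φ := sgn D) (P := P) (fun w hw => ?_) (hg.mem u u')) w hw
    rw [sgn_mon]
    refine P.smul_mem _ ((hP _).2 fun v hv => ?_)
    have : v = w := by
      by_contra hne
      exact hv (by simp [mon, Ne.symm hne])
    rw [this]; exact hw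
  have hzX : ∀ v u w, (z v u).coeff w ≠ 0 → wdeg D w + dg v = m + 2 ∧ w ≠ 1 := by
    intro v u w hw
    by_cases hu : dg u = m
    · simp only [z, hu, if_true, defect_apply] at hw
      refine ⟨?_, ?_⟩
      · by_contra hne
        apply hw
        have h1 : (if u = v then linear h else 0 : Tens Q S).coeff w = 0 := by
          split_ifs with huv
          · by_contra h
            have := ((mem_homog D).1 hA.h_mem w h).2
            rw [← huv] at hne
            omega
          · rfl
        have h2 : (deriv D f (g u v)).coeff w = 0 := by
          by_contra h
          have := coeff_deriv_deg hf (hg.mem u v) w h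
          omega
        have h3 : ∀ u', (sgn D (g u u') * g u' v).coeff w = 0 := by
          intro u'
          by_contra h
          have := coeff_mul_deg D (hsg u u') (hg.mem u' v) w h
          omega
        simp [h1, h2, h3]
      -- The constant term of the defect is the square of the differential `e`, up to sign, hence
      -- zero. The correction can thus avoid the empty word, which keeps `g_lin` intact.
      · rintro rfl
        apply hw
        have h1 : (if u = v then linear h else 0 : Tens Q S).coeff 1 = 0 := by
          split_ifs with huv
          · by_contra h
            have := ((mem_homog D).1 hA.h_mem 1 h).1
            simp at this
          · rfl
        have h3 : ∀ u', (sgn D (g u u') * g u' v).coeff 1 = e v u' * e u' u := by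
          intro u'
          rw [coeff_mul_one, coeff_sgn_one, hg.lin, hg.lin, mul_comm]
        simp [h1, coeff_deriv_one D hf, h3, hG.d_d]
    · simp [z, hu] at hw
  -- In a row `u''` of degree below `m` the defect already vanishes, so the Bianchi identity reads
  -- `g * defect = 0` there. Rows of `defect` below degree `m` drop out, and entries of `g` landing
  -- in degree `m` or more are the scalars `e`.
  have hz1 : ∀ v u', ∑ u, e u u' • z v u = 0 := by
    intro v u''
    by_cases hu : dg u'' < m
    · have hb := congrFun (congrFun
        (bianchi hf hrel (hA.deriv_h hf') hA.sgn_h g) u'') v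
      have h0 : ∀ u', defect D f (linear h) g u'' u' = 0 := hg.rel u'' hu
      rw [Matrix.add_apply, Matrix.map_apply, Matrix.mul_apply, Matrix.mul_apply] at hb
      simp only [Matrix.map_apply, h0, map_zero, zero_mul, Finset.sum_const_zero, add_zero] at hb
      rw [← hb]
      refine Finset.sum_congr rfl fun u' _ => ?_
      rcases lt_trichotomy (dg u') m with h1 | h1 | h1
      · simp [z, h1.ne, hg.rel u' h1]
      · rw [hg.eq_smul_one hA (by omega)]
        simp [z, h1]
      · rw [hg.eq_smul_one hA (by omega)]
        by_cases h2 : e u' u'' = 0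
        · simp [h2]
        · have := hG.d_deg _ _ h2
          omega
    · refine Finset.sum_eq_zero fun u _ => ?_
      by_cases h2 : e u u'' = 0
      · simp [h2]
      · have := hG.d_deg _ _ h2
        simp [z, show dg u ≠ m by omega]
  -- Only `m = 0` matters. In degree zero the defect is `h` on the diagonal minus boundaries; `h`
  -- kills the module and the augmentation kills boundaries.
  have hz2 : ∀ v w, ∑ u, (z v u).coeff w • gen u = 0 := by
    intro v w
    by_cases hm : m = 0
    · by_cases hv : dg v = 0
      · have h1 : ∀ u, (z v u).coeff w • gen u =
            (if u = v then (linear h).coeff w • gen u else 0) -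
              ∑ u', (g u' v).coeff w • e u' u • gen u := by
          intro u
          by_cases hu : dg u = 0
          · have hguv : g u v = 0 := by
              rw [hg.eq_smul_one hA (by omega)]
              by_cases h2 : e v u = 0
              · simp [h2]
              · have := hG.d_deg _ _ h2
                omega
            have h3 : ∀ u', g u u' = e u' u • 1 := fun u' => hg.eq_smul_one hA (by omega)
            simp only [z, hm, hu, if_true, defect_apply, hguv, map_zero, sub_zero, h3, map_smul,
              sgn_one, smul_mul_assoc, one_mul]
            simp only [MonoidAlgebra.coeff_sub, MonoidAlgebra.coeff_sum, Finsupp.sub_apply,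
              Finsupp.finsetSum_apply, MonoidAlgebra.coeff_smul_apply, sub_smul, Finset.sum_smul,
              smul_smul, smul_eq_mul]
            congr 1
            · split_ifs <;> simp
            · exact Finset.sum_congr rfl fun _ _ => by rw [mul_comm]
          · have : gen u = 0 := by
              by_contra h
              exact hu (hG.gen_deg u h)
            simp [this]
        simp only [h1, Finset.sum_sub_distrib]
        rw [Finset.sum_comm]
        simp only [← Finset.smul_sum, hG.d_gen, smul_zero, Finset.sum_const_zero, sub_zero]
        simp [linear, Finset.sum_smul, mul_comm (h _), mul_smul, hN, Finsupp.finsetSum_apply]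
      · refine Finset.sum_eq_zero fun u _ => ?_
        have : (z v u).coeff w = 0 := by
          by_contra h
          obtain ⟨h1, h2⟩ := hzX v u w h
          exact h2 (eq_one_of_wdeg_le_one hA.two_le (by omega))
        rw [this, zero_smul]
    · refine Finset.sum_eq_zero fun u _ => ?_
      by_cases hu : gen u = 0
      · simp [hu]
      · have := hG.gen_deg u hu
        simp [z, show dg u ≠ m by omega]
  have hcoeff : ∀ (v u' : U) (w : FreeMonoid S), ∑ u, (z v u).coeff w * e u u' = 0 := by
    intro v u' w
    have := congrArg (fun t : Tens Q S => t.coeff w) (hz1 v u')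
    simpa [Finsupp.finsetSum_apply, mul_comm] using this
  choose y hy1 hy2 hy3 using fun v => exists_coeffwise_lift (hG.exact m) (z := z v)
    (fun u hu => by simp [z, hu]) (X := {w | wdeg D w + dg v = m + 2 ∧ w ≠ 1})
    (hzX v) (fun w _ => ⟨fun u' => hcoeff v u' w, hz2 v w⟩)
  refine ⟨Matrix.of fun u v => g u v + y v u, fun u u' w hw => ?_, fun u u' => ?_,
    fun u hu v => ?_⟩
  · by_cases h1 : (g u u').coeff w = 0
    · have h2 : (y u' u).coeff w ≠ 0 := by
        intro h2
        exact hw (by simp [h1, h2])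
      have h3 : dg u = m + 1 := by
        by_contra h3
        exact h2 (by rw [hy1 u' u h3]; rfl)
      have := (hy2 u' u w h2).1
      omega
    · exact hg.mem u u' w h1
  · have : (y u' u).coeff 1 = 0 := by
      by_contra h
      exact (hy2 u' u 1 h).2 rfl
    simp [this, hg.lin]
  · have h0 : ∀ v, y v u = 0 := fun v => hy1 v u (by omega)
    -- `y v u'` is nonzero only for `dg u' = m + 1`, where `g u u'` is the scalar `e u' u`; so the
    -- correction changes the defect exactly by the boundary of `y`.
    have h1 : ∀ u', sgn D (g u u') * y v u' = e u' u • y v u' := by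
      intro u'
      by_cases hu' : dg u' = m + 1
      · rw [hg.eq_smul_one hA (by omega)]
        simp [sgn_one]
      · simp [hy1 v u' hu']
    simp only [defect_apply, Matrix.of_apply, h0, add_zero, mul_add, Finset.sum_add_distrib, h1,
      hy3]
    rw [← sub_sub, ← defect_apply]
    by_cases hm : dg u = m
    · simp [z, hm]
    · simp [z, hm, hg.rel u (by omega)]

theorem exists_connection (hA : IsCyclicResolution D d h)
    (hf : ∀ s, f s ∈ homog D Q 1 (D s + 1))
    (hf' : ∀ s, f s - linear (fun s' => d s' s) ∈ homog D Q 2 (D s + 1))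
    (hrel : ∀ s, deriv D f (f s) = linear h * letter Q s - letter Q s * linear h)
    (hG : IsModuleResolution dg e gen) (hN : ∀ s (n : N), h s • n = 0) :
    ∃ g : Matrix U U (Tens Q S),
      (∀ u u' w, (g u u').coeff w ≠ 0 → wdeg D w + dg u' = dg u + 1) ∧
      (∀ u u', (g u u').coeff 1 = e u' u) ∧ defect D f (linear h) g = 0 := by
  have key : ∀ m, ∃ g, IsConnection D f (linear h) dg e m g := by
    intro m
    induction m with
    | zero =>
      refine ⟨Matrix.of fun u u' => e u' u • 1, fun u u' w hw => ?_, fun u u' => ?_,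
        fun u hu => absurd hu (Nat.not_lt_zero _)⟩
      · have hw' : e u' u * (1 : Tens Q S).coeff w ≠ 0 := hw
        have h1 : w = 1 := by
          by_contra hne
          apply hw'
          rw [← mon_one]
          simp [mon, Ne.symm hne]
        have := hG.d_deg u' u (left_ne_zero_of_mul hw')
        rw [h1, wdeg_one]; omega
      · simp
    | succ m ih => exact connection_step hA hf hf' hrel hG hN ih.choose_spec
  obtain ⟨g, hg⟩ := key (Finset.univ.sup dg + 1)
  refine ⟨g, hg.mem, hg.lin, ?_⟩
  ext u v : 1
  exact hg.rel u (Nat.lt_succ_of_le (Finset.le_sup (f := dg) (Finset.mem_univ u))) v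

end

end CurvedModule


/-! ### The total operator on words ending in `U`, and its transpose. -/

section BarConstruction

variable {Q : Type*} [CommRing Q] {S U : Type*}

/-- The basis vector of a word `w` followed by `u`. -/
noncomputable def bas (Q : Type*) [CommRing Q] [DecidableEq U] (y : FreeMonoid S × U) :
    U → Tens Q S :=
  Pi.single y.2 (mon Q y.1)

/-- The degree of a word ending in an element of `U`. -/
def totdeg (D : S → ℕ) (dg : U → ℕ) (y : FreeMonoid S × U) : ℕ := wdeg D y.1 + dg y.2

/-- Prepend a letter to a word ending in an element of `U`. -/
def cons (s : S) (y : FreeMonoid S × U) : FreeMonoid S × U := (FreeMonoid.of s * y.1, y.2)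

theorem totdeg_cons (D : S → ℕ) (dg : U → ℕ) (s : S) (y : FreeMonoid S × U) :
    totdeg D dg (cons s y) = D s + totdeg D dg y := by
  simp [totdeg, cons, add_assoc]

/-- The function on words with prescribed values on words of positive length. -/
def consFun (φ : S → FreeMonoid S × U → Q) (x : FreeMonoid S × U) : Q :=
  match x.1.toList with
  | [] => 0
  | s :: p => φ s (FreeMonoid.ofList p, x.2)

theorem consFun_one (φ : S → FreeMonoid S × U → Q) (u : U) : consFun φ (1, u) = 0 := rfl

theorem consFun_cons (φ : S → FreeMonoid S × U → Q) (s : S) (y : FreeMonoid S × U) :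
    consFun φ (cons s y) = φ s y := rfl

theorem word_cases (x : FreeMonoid S × U) : (∃ u, x = (1, u)) ∨ ∃ s y, x = cons s y := by
  obtain ⟨w, u⟩ := x
  induction w using FreeMonoid.inductionOn' with
  | one => exact Or.inl ⟨u, rfl⟩
  | of_mul s p _ => exact Or.inr ⟨s, (p, u), rfl⟩

theorem letter_smul_bas [DecidableEq U] (s : S) (y : FreeMonoid S × U) :
    letter Q s • bas Q y = bas Q (cons s y) := by
  funext u
  by_cases hu : u = y.2
  · subst hu
    simp [bas, cons, mon_mul, letter]
  · simp [bas, cons, hu]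

variable [Fintype U]

/-- The differential of the free module on `U` over the tensor algebra, with connection `g`. -/
noncomputable def total (D : S → ℕ) (f : S → Tens Q S) (g : Matrix U U (Tens Q S)) :
    (U → Tens Q S) →ₗ[Q] (U → Tens Q S) where
  toFun e v := deriv D f (e v) + ∑ u, sgn D (e u) * g u v
  map_add' a b := by
    funext v
    simp only [Pi.add_apply, map_add, add_mul, Finset.sum_add_distrib]
    abel
  map_smul' c a := by
    funext v
    simp [Finset.smul_sum]

theorem total_apply (D : S → ℕ) (f : S → Tens Q S) (g : Matrix U U (Tens Q S))
    (e : U → Tens Q S) (v : U) :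
    total D f g e v = deriv D f (e v) + ∑ u, sgn D (e u) * g u v := rfl

theorem total_smul (D : S → ℕ) (f : S → Tens Q S) (g : Matrix U U (Tens Q S)) (t : Tens Q S)
    (e : U → Tens Q S) :
    total D f g (t • e) = deriv D f t • e + sgn D t • total D f g e := by
  funext v
  simp only [total_apply, Pi.smul_apply, Pi.add_apply, smul_eq_mul, deriv_mul, sgn_mul, mul_add,
    Finset.mul_sum, mul_assoc, add_assoc]

/-- The pairing of a function on words with an element of the free module on words. -/
noncomputable def pair {N : Type*} [AddCommGroup N] [Module Q N] (v : FreeMonoid S × U → N) :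
    (U → Tens Q S) →ₗ[Q] N :=
  ∑ u, extend (fun w => v (w, u)) ∘ₗ LinearMap.proj u

theorem pair_apply {N : Type*} [AddCommGroup N] [Module Q N] (v : FreeMonoid S × U → N)
    (e : U → Tens Q S) : pair v e = ∑ u, extend (fun w => v (w, u)) (e u) := by
  simp [pair]

theorem pair_eq_zero {N : Type*} [AddCommGroup N] [Module Q N] {v : FreeMonoid S × U → N}
    {e : U → Tens Q S}
    (h : ∀ u w, (e u).coeff w ≠ 0 → v (w, u) = 0) : pair v e = 0 := by
  rw [pair_apply]
  refine Finset.sum_eq_zero fun u _ => ?_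
  rw [extend_apply]
  refine Finset.sum_eq_zero fun w hw => ?_
  simp only [h u w (by simpa using hw), smul_zero]

variable [DecidableEq U]

/-- The derivation contributes `H * e - e * H` and the curvature equation of the connection
contributes `e * H`; left multiplication by `H` is what remains. -/
theorem total_total {D : S → ℕ} {f : S → Tens Q S} {H : Tens Q S}
    {g : Matrix U U (Tens Q S)} (hf : ∀ s, f s ∈ homog D Q 1 (D s + 1))
    (hrel : ∀ s, deriv D f (f s) = H * letter Q s - letter Q s * H)
    (hg : defect D f H g = 0) (e : U → Tens Q S) :
    total D f g (total D f g e) = H • e := by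
  funext v
  have h1 : ∀ u, deriv D f (g u v) + ∑ u', sgn D (g u u') * g u' v = if u = v then H else 0 := by
    intro u
    have := congrFun (congrFun hg u) v
    rw [defect_apply, Matrix.zero_apply, sub_sub, sub_eq_zero] at this
    exact this.symm
  have h2 : ∑ u, e u * (deriv D f (g u v) + ∑ u', sgn D (g u u') * g u' v) = e v * H := by
    simp [h1]
  have h3 : deriv D f (deriv D f (e v)) = H * e v - e v * H :=
    deriv_deriv hf fun w _ s _ => hrel s
  simp only [total_apply, map_add, map_sum, deriv_mul, sgn_mul, sgn_sgn, sgn_deriv hf, h3,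
    Finset.sum_add_distrib, add_mul, neg_mul, Finset.sum_neg_distrib, Pi.smul_apply, smul_eq_mul]
  simp only [mul_add, Finset.sum_add_distrib, Finset.mul_sum] at h2
  rw [← sub_eq_zero] at h2 ⊢
  rw [← h2]
  simp only [Finset.sum_mul, mul_assoc]
  rw [Finset.sum_comm (f := fun x i => e i * (sgn D (g i x) * g x v))]
  abel

section Pairing

variable {N : Type*} [AddCommGroup N] [Module Q N]

theorem pair_bas (v : FreeMonoid S × U → N) (y : FreeMonoid S × U) :
    pair v (bas Q y) = v y := by
  rw [pair_apply, Finset.sum_eq_single y.2]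
  · simp [bas, extend_mon]
  · intro u _ hu
    simp [bas, hu]
  · simp

theorem pi_linearMap_ext {φ ψ : (U → Tens Q S) →ₗ[Q] N} (h : ∀ y, φ (bas Q y) = ψ (bas Q y)) :
    φ = ψ :=
  LinearMap.pi_ext' fun u => linearMap_ext fun w => h (w, u)

theorem pair_sub (v v' : FreeMonoid S × U → N) (e : U → Tens Q S) :
    pair (v - v') e = pair v e - pair v' e := by
  suffices h : pair (v - v') = pair v - pair (Q := Q) v' from LinearMap.congr_fun h e
  exact pi_linearMap_ext fun y => by simp [pair_bas]

/-- The transpose of `total`, on functions on words. -/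
noncomputable def transp (D : S → ℕ) (f : S → Tens Q S) (g : Matrix U U (Tens Q S))
    (v : FreeMonoid S × U → N) (y : FreeMonoid S × U) : N :=
  pair v (total D f g (bas Q y))

variable {D : S → ℕ} {f : S → Tens Q S} {g : Matrix U U (Tens Q S)}

theorem transp_sub (v v' : FreeMonoid S × U → N) :
    transp D f g (v - v') = transp D f g v - transp D f g v' :=
  funext fun _ => pair_sub _ _ _

theorem pair_transp (v : FreeMonoid S × U → N) (e : U → Tens Q S) :
    pair (transp D f g v) e = pair v (total D f g e) := by
  suffices h : pair (transp D f g v) = pair v ∘ₗ total D f g from LinearMap.congr_fun h e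
  exact pi_linearMap_ext fun y => by rw [pair_bas]; rfl

theorem pair_linear_smul [Fintype S] (v : FreeMonoid S × U → N) (c : S → Q)
    (y : FreeMonoid S × U) :
    pair v (linear c • bas Q y) = ∑ s, c s • v (cons s y) := by
  rw [linear, Finset.sum_smul, map_sum]
  refine Finset.sum_congr rfl fun s _ => ?_
  rw [smul_assoc, letter_smul_bas, map_smul, pair_bas]

theorem transp_transp [Fintype S] {h : S → Q} (hf : ∀ s, f s ∈ homog D Q 1 (D s + 1))
    (hrel : ∀ s, deriv D f (f s) = linear h * letter Q s - letter Q s * linear h)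
    (hg : defect D f (linear h) g = 0) (v : FreeMonoid S × U → N) (y : FreeMonoid S × U) :
    transp D f g (transp D f g v) y = ∑ s, h s • v (cons s y) := by
  rw [transp, pair_transp, total_total hf hrel hg, pair_linear_smul]

end Pairing

variable {D : S → ℕ} {f : S → Tens Q S} {g : Matrix U U (Tens Q S)} {dg : U → ℕ}

theorem total_bas_deg (hf : ∀ s, f s ∈ homog D Q 1 (D s + 1))
    (hg : ∀ u u' w, (g u u').coeff w ≠ 0 → wdeg D w + dg u' = dg u + 1) (y : FreeMonoid S × U)
    (u : U) (w : FreeMonoid S) (hw : (total D f g (bas Q y) u).coeff w ≠ 0) :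
    totdeg D dg (w, u) = totdeg D dg y + 1 := by
  by_contra hne
  apply hw
  have hbas : ∀ v, bas Q y v = if v = y.2 then mon Q y.1 else 0 := fun v => by
    simp [bas, Pi.single_apply]
  have hm : mon Q y.1 ∈ homog D Q 0 (wdeg D y.1) := mon_mem_homog D (Nat.zero_le _) rfl
  have h1 : (deriv D f (bas Q y u)).coeff w = 0 := by
    rw [hbas]
    split_ifs with hu
    · by_contra h
      have := ((mem_homog D).1 (deriv_mem_homog hf hm) w h).2
      subst hu
      simp only [totdeg] at hne
      omega
    · simp
  have h2 : (∑ v, sgn D (bas Q y v) * g v u).coeff w = 0 := by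
    rw [Finset.sum_eq_single y.2]
    · rw [hbas, if_pos rfl]
      by_contra h
      have := coeff_mul_deg D (k := dg y.2) (n := wdeg D y.1 + dg y.2)
        (fun w hw => by rw [((mem_homog D).1 (sgn_mem D hm) w hw).2]) (hg y.2 u) w h
      exact hne this
    · intro v _ hv
      simp [hbas, hv]
    · simp
  rw [total_apply, MonoidAlgebra.coeff_add, Finsupp.add_apply, h1, h2, add_zero]

theorem total_bas_one (u : U) : total D f g (bas Q (1, u)) = g u := by
  funext v
  rw [total_apply, Finset.sum_eq_single u]
  · have : deriv D f (bas Q (1, u) v) = 0 := by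
      by_cases hv : v = u
      · subst hv; simp [bas, mon_one, deriv_one]
      · simp [bas, hv]
    rw [this, zero_add]
    simp [bas, mon_one, sgn_one]
  · intro u' _ hu'
    simp [bas, hu']
  · simp

theorem coeff_mon_mul_ne_zero {v : FreeMonoid S} {t : Tens Q S} {w : FreeMonoid S}
    (hw : (mon Q v * t).coeff w ≠ 0) : ∃ w', w = v * w' ∧ t.coeff w' ≠ 0 := by
  by_contra hne
  push Not at hne
  apply hw
  let P : Submodule Q (Tens Q S) := MonoidAlgebra.supported Q Q {w}ᶜ
  have hP : ∀ t, t ∈ P ↔ t.coeff w = 0 := by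
    intro t
    rw [MonoidAlgebra.mem_supported']
    simp
  rw [← hP]
  refine mem_of_supported (φ := LinearMap.mulLeft Q (mon Q v)) (X := {w' | w ≠ v * w'})
    (fun w' hw' => ?_) (fun w' hw' h => hw' (hne w' h))
  rw [LinearMap.mulLeft_apply, ← mon_mul, hP]
  have : v * w' ≠ w := Ne.symm hw'
  simp [mon, this]

theorem coeff_mul_mon_ne_zero {v : FreeMonoid S} {t : Tens Q S} {w : FreeMonoid S}
    (hw : (t * mon Q v).coeff w ≠ 0) : ∃ w', w = w' * v ∧ t.coeff w' ≠ 0 := by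
  by_contra hne
  push Not at hne
  apply hw
  let P : Submodule Q (Tens Q S) := MonoidAlgebra.supported Q Q {w}ᶜ
  have hP : ∀ t, t ∈ P ↔ t.coeff w = 0 := by
    intro t
    rw [MonoidAlgebra.mem_supported']
    simp
  rw [← hP]
  refine mem_of_supported (φ := LinearMap.mulRight Q (mon Q v)) (X := {w' | w ≠ w' * v})
    (fun w' hw' => ?_) (fun w' hw' h => hw' (hne w' h))
  rw [LinearMap.mulRight_apply, ← mon_mul, hP]
  have : w' * v ≠ w := Ne.symm hw'
  simp [mon, this]

variable {N : Type*} [AddCommGroup N] [Module Q N]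

theorem transp_eq_zero (hf : ∀ s, f s ∈ homog D Q 1 (D s + 1))
    (hg : ∀ u u' w, (g u u').coeff w ≠ 0 → wdeg D w + dg u' = dg u + 1)
    {F : FreeMonoid S × U → N} {y : FreeMonoid S × U}
    (hF : ∀ x, totdeg D dg x = totdeg D dg y + 1 → F x = 0) : transp D f g F y = 0 :=
  pair_eq_zero fun u w hw => hF (w, u) (total_bas_deg hf hg y u w hw)

theorem transp_bas_cons (s : S) (F : FreeMonoid S × U → N) (y : FreeMonoid S × U) :
    transp D f g F (cons s y) = pair F (f s • bas Q y) +
      (-1 : Q) ^ D s • pair F (letter Q s • total D f g (bas Q y)) := by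
  rw [transp, ← letter_smul_bas, total_smul, deriv_letter, sgn_eq D (letter_mem_homog D s), map_add,
    smul_assoc ((-1 : Q) ^ D s), LinearMap.map_smul (pair F) ((-1 : Q) ^ D s)]

/-- Every term of the differential of `s · y`, except those replacing `s` by a single letter, leaves
a tail of degree larger than that of `y`, where `F` vanishes. So the leading term for the filtration
by tail degree is the differential of the cyclic resolution. -/
theorem transp_leading [Fintype S] {d : S → S → Q} (hD : ∀ s, 2 ≤ D s)
    (hf : ∀ s, f s ∈ homog D Q 1 (D s + 1))
    (hf' : ∀ s, f s - linear (fun s' => d s' s) ∈ homog D Q 2 (D s + 1))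
    (hg : ∀ u u' w, (g u u').coeff w ≠ 0 → wdeg D w + dg u' = dg u + 1) (y : FreeMonoid S × U)
    {F : FreeMonoid S × U → N}
    (hF : ∀ s y', totdeg D dg y < totdeg D dg y' → F (cons s y') = 0) (s : S) :
    transp D f g F (cons s y) = ∑ s', d s' s • F (cons s' y) := by
  have h1 : pair F (letter Q s • total D f g (bas Q y)) = 0 := by
    refine pair_eq_zero fun u w hw => ?_
    rw [Pi.smul_apply, smul_eq_mul] at hw
    obtain ⟨w', rfl, hw'⟩ := coeff_mon_mul_ne_zero hw
    have := total_bas_deg hf hg y u w' hw'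
    exact hF s (w', u) (by omega)
  have h2 : pair F ((f s - linear (fun s' => d s' s)) • bas Q y) = 0 := by
    refine pair_eq_zero fun u w hw => ?_
    rw [Pi.smul_apply, smul_eq_mul] at hw
    by_cases hu : u = y.2
    · subst hu
      rw [bas, Pi.single_eq_same] at hw
      obtain ⟨w', rfl, hw'⟩ := coeff_mul_mon_ne_zero hw
      have hl := ((mem_homog D).1 (hf' s) w' hw').1
      induction w' using FreeMonoid.inductionOn' with
      | one => simp at hl
      | of_mul t p _ =>
        refine (congrArg F ?_).trans (hF t (p * y.1, y.2) ?_)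
        · simp [cons, mul_assoc]
        · rw [FreeMonoid.length_mul, FreeMonoid.length_of] at hl
          obtain ⟨s, hs⟩ : ∃ s, s ∈ p.toList :=
            List.exists_mem_of_length_pos (show 0 < p.length by omega)
          have := D_le_wdeg (D := D) hs
          have := hD s
          simp only [totdeg, wdeg_mul]
          omega
    · simp [bas, hu] at hw
  rw [transp_bas_cons, h1, smul_zero, add_zero, ← pair_linear_smul]
  rw [sub_smul, map_sub, sub_eq_zero] at h2
  exact h2

end BarConstruction


/-! ### Exactness of the transposed operator modulo the ideal of `h`. -/

section Exactness

variable {Q : Type*} [CommRing Q] {S U : Type*} [Fintype S] [Fintype U] [DecidableEq U]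
  {N : Type*} [AddCommGroup N] [Module Q N]

/-- A pair of finite free resolutions, together with a curved differential on the tensor algebra
and a compatible connection on the free module on `U`. -/
structure IsTwisting (D : S → ℕ) (d : S → S → Q) (h : S → Q) (dg : U → ℕ) (e : U → U → Q)
    (gen : U → N) (f : S → Tens Q S) (g : Matrix U U (Tens Q S)) : Prop where
  alg : IsCyclicResolution D d h
  mod : IsModuleResolution dg e gen
  f_mem : ∀ s, f s ∈ homog D Q 1 (D s + 1)
  f_lin : ∀ s, f s - linear (fun s' => d s' s) ∈ homog D Q 2 (D s + 1)
  f_rel : ∀ s, deriv D f (f s) = linear h * letter Q s - letter Q s * linear h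
  g_mem : ∀ u u' w, (g u u').coeff w ≠ 0 → wdeg D w + dg u' = dg u + 1
  g_lin : ∀ u u', (g u u').coeff 1 = e u' u
  g_rel : defect D f (linear h) g = 0

variable {D : S → ℕ} {d : S → S → Q} {h : S → Q} {dg : U → ℕ} {e : U → U → Q}
  {gen : U → N} {f : S → Tens Q S} {g : Matrix U U (Tens Q S)}

theorem exists_twisting (hA : IsCyclicResolution D d h) (hG : IsModuleResolution dg e gen)
    (hN : ∀ s (n : N), h s • n = 0) :
    ∃ (f : S → Tens Q S) (g : Matrix U U (Tens Q S)), IsTwisting D d h dg e gen f g := by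
  obtain ⟨f, h1, h2, h3⟩ := hA.exists_curved
  obtain ⟨g, h4, h5, h6⟩ := exists_connection hA h1 h2 h3 hG hN
  exact ⟨f, g, hA, hG, h1, h2, h3, h4, h5, h6⟩

namespace IsTwisting

variable (T : IsTwisting D d h dg e gen f g)
include T

theorem transp_transp (v : FreeMonoid S × U → Q) (y : FreeMonoid S × U) :
    transp D f g (transp D f g v) y = ∑ s, h s * v (cons s y) := by
  simpa using GolodBound.transp_transp T.f_mem T.f_rel T.g_rel v y

theorem leading {y : FreeMonoid S × U} {F : FreeMonoid S × U → Q}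
    (hF : ∀ s y', totdeg D dg y < totdeg D dg y' → F (cons s y') = 0) (s : S) :
    transp D f g F (cons s y) = ∑ s', d s' s * F (cons s' y) :=
  transp_leading T.alg.two_le T.f_mem T.f_lin T.g_mem y hF s

theorem transp_deg {F : FreeMonoid S × U → Q} {n : ℕ} (hF : ∀ x, F x ≠ 0 → totdeg D dg x = n)
    (y : FreeMonoid S × U) (hy : transp D f g F y ≠ 0) : totdeg D dg y + 1 = n := by
  by_contra hne
  refine hy (transp_eq_zero T.f_mem T.g_mem fun x hx => ?_)
  by_contra hFx
  have := hF x hFx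
  omega

/-- The transpose squares to contraction with `h`, so a preimage `F` of `v` must contract with `h`
to the transpose of `v`. Membership in the ideal gives such an `F`, on words starting with a letter
of degree 2. -/
theorem base_lift {v : FreeMonoid S × U → Q} {n : ℕ} (hv : ∀ x, v x ≠ 0 → totdeg D dg x = n)
    (hI : ∀ y, transp D f g v y ∈ Ideal.span (Set.range h)) :
    ∃ F : FreeMonoid S × U → Q, (∀ x, F x ≠ 0 → totdeg D dg x = n + 1) ∧ (∀ u, F (1, u) = 0) ∧
      ∀ y, ∑ s, h s * F (cons s y) = transp D f g v y := by
  classical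
  have key : ∀ y, ∃ c : S → Q, ∑ s, c s * h s = transp D f g v y := fun y =>
    Ideal.mem_span_range_iff_exists_fun.1 (hI y)
  choose c hc using key
  refine ⟨consFun fun s y => if D s = 2 ∧ totdeg D dg y + 1 = n then c y s else 0,
    fun x hx => ?_, consFun_one _, fun y => ?_⟩
  · rcases word_cases x with ⟨u, rfl⟩ | ⟨s, y, rfl⟩
    · exact absurd (consFun_one _ u) hx
    · rw [consFun_cons] at hx
      have := (ite_ne_right_iff.1 hx).1
      rw [totdeg_cons]
      omega
  · simp only [consFun_cons]
    by_cases hy : totdeg D dg y + 1 = n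
    · rw [← hc]
      refine Finset.sum_congr rfl fun s _ => ?_
      by_cases hs : h s = 0
      · simp [hs]
      · simp [hy, T.alg.h_deg s hs, mul_comm]
    · have : transp D f g v y = 0 := by
        by_contra h
        exact hy (T.transp_deg hv y h)
      simp [hy, this]

/-- The error `r` has transpose zero, so for each tail of degree `j` its leading part is a cycle in
the cyclic resolution and hence a boundary. The correction uses first letters of degree `n - j + 1 ≥
3`, invisible to `h`, so the contraction condition on `F` survives. -/
theorem step_lift {v : FreeMonoid S × U → Q} {n j : ℕ} (hv : ∀ x, v x ≠ 0 → totdeg D dg x = n)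
    (hj : j + 2 ≤ n) {F : FreeMonoid S × U → Q} (hF : ∀ x, F x ≠ 0 → totdeg D dg x = n + 1)
    (hF1 : ∀ u, F (1, u) = 0) (hFv : ∀ y, ∑ s, h s * F (cons s y) = transp D f g v y)
    (hr : ∀ s y, j + 1 ≤ totdeg D dg y → (v - transp D f g F) (cons s y) = 0) :
    ∃ F : FreeMonoid S × U → Q, (∀ x, F x ≠ 0 → totdeg D dg x = n + 1) ∧ (∀ u, F (1, u) = 0) ∧
      (∀ y, ∑ s, h s * F (cons s y) = transp D f g v y) ∧
      ∀ s y, j ≤ totdeg D dg y → (v - transp D f g F) (cons s y) = 0 := by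
  classical
  set r := v - transp D f g F with hrdef
  have hrn : ∀ x, r x ≠ 0 → totdeg D dg x = n := by
    intro x hx
    by_cases hvx : v x = 0
    · have : transp D f g F x ≠ 0 := by
        intro h0
        exact hx (by simp [r, hvx, h0])
      have := T.transp_deg hF x this
      omega
    · exact hv x hvx
  have htr : transp D f g r = 0 := by
    rw [hrdef, transp_sub]
    funext y
    simp [T.transp_transp, hFv]
  have key : ∀ y, ∃ w : S → Q, (∀ s, w s ≠ 0 → D s = n - j + 1) ∧
      (totdeg D dg y = j → ∀ s', ∑ s, w s * d s s' = r (cons s' y)) := by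
    intro y
    by_cases hy : totdeg D dg y = j
    · obtain ⟨w, hw1, hw2⟩ := T.alg.exact (n - j) (fun s => r (cons s y)) (fun s hs => by
          have := hrn _ hs
          rw [totdeg_cons] at this
          omega) ⟨fun s' => by
          have := T.leading (F := r) (y := y) (fun s y' hy' => hr s y' (by omega)) s'
          rw [htr, Pi.zero_apply] at this
          rw [this]
          exact Finset.sum_congr rfl fun _ _ => mul_comm _ _, by
          have := T.transp_transp r y
          rw [htr] at this
          have h0 : transp D f g (0 : FreeMonoid S × U → Q) y = 0 :=
            pair_eq_zero fun _ _ _ => rfl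
          rw [h0] at this
          rw [this]
          exact Finset.sum_congr rfl fun _ _ => mul_comm _ _⟩
      exact ⟨w, hw1, fun _ => hw2⟩
    · exact ⟨0, by simp, fun h => absurd h hy⟩
  choose w hw1 hw2 using key
  let G : FreeMonoid S × U → Q := consFun fun s y => if totdeg D dg y = j then -w y s else 0
  have hG1 : ∀ s y, totdeg D dg y ≠ j → G (cons s y) = 0 := fun s y hy => by
    simp [G, consFun_cons, hy]
  have hG2 : ∀ s y, totdeg D dg y = j → G (cons s y) = -w y s := fun s y hy => by
    simp [G, consFun_cons, hy]
  have hGF : transp D f g (F - G) = transp D f g F - transp D f g G := transp_sub _ _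
  refine ⟨F - G, fun x hx => ?_, fun u => ?_, fun y => ?_, fun s y hy => ?_⟩
  · by_cases hFx : F x = 0
    · have hGx : G x ≠ 0 := fun h0 => hx (by simp [hFx, h0])
      rcases word_cases x with ⟨u, rfl⟩ | ⟨s, y, rfl⟩
      · exact absurd (consFun_one _ u) hGx
      · have hy : totdeg D dg y = j := by
          by_contra h0
          exact hGx (hG1 s y h0)
        rw [hG2 s y hy] at hGx
        have := hw1 y s (neg_ne_zero.1 hGx)
        rw [totdeg_cons]
        omega
    · exact hF x hFx
  · have : G (1, u) = 0 := consFun_one _ u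
    simp [hF1, this]
  · have : ∀ s, h s * G (cons s y) = 0 := by
      intro s
      by_cases hy : totdeg D dg y = j
      · rw [hG2 s y hy]
        by_cases hs : h s = 0
        · simp [hs]
        · have h2 := T.alg.h_deg s hs
          have : w y s = 0 := by
            by_contra h0
            have := hw1 y s h0
            omega
          simp [this]
      · rw [hG1 s y hy, mul_zero]
    simp [mul_sub, this, hFv]
  · have h1 : transp D f g G (cons s y) = ∑ s', d s' s * G (cons s' y) :=
      T.leading (fun s y' hy' => hG1 s y' (by omega)) s
    have h2 : (v - transp D f g (F - G)) (cons s y) = r (cons s y) + transp D f g G (cons s y) := by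
      rw [hGF]
      simp only [r, Pi.sub_apply]
      ring
    rw [h2, h1]
    by_cases hyj : totdeg D dg y = j
    · rw [← hw2 y hyj, ← Finset.sum_add_distrib]
      refine Finset.sum_eq_zero fun s' _ => ?_
      rw [hG2 s' y hyj]
      ring
    · rw [hr s y (by omega), zero_add]
      refine Finset.sum_eq_zero fun s' _ => ?_
      rw [hG1 s' y hyj, mul_zero]

/-- Descending induction on the tail degree. It starts at `n - 1`, where a word with a letter of
degree at least 2 in front already exceeds degree `n`. -/
theorem exists_lift {v : FreeMonoid S × U → Q} {n : ℕ} (hv : ∀ x, v x ≠ 0 → totdeg D dg x = n)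
    (hI : ∀ y, transp D f g v y ∈ Ideal.span (Set.range h)) :
    ∃ F : FreeMonoid S × U → Q, (∀ x, F x ≠ 0 → totdeg D dg x = n + 1) ∧ (∀ u, F (1, u) = 0) ∧
      (∀ y, ∑ s, h s * F (cons s y) = transp D f g v y) ∧
      ∀ s y, (v - transp D f g F) (cons s y) = 0 := by
  have key : ∀ k, ∃ F : FreeMonoid S × U → Q,
      (∀ x, F x ≠ 0 → totdeg D dg x = n + 1) ∧ (∀ u, F (1, u) = 0) ∧
      (∀ y, ∑ s, h s * F (cons s y) = transp D f g v y) ∧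
      ∀ s y, n - 1 - k ≤ totdeg D dg y → (v - transp D f g F) (cons s y) = 0 := by
    intro k
    induction k with
    | zero =>
      obtain ⟨F, h1, h2, h3⟩ := T.base_lift hv hI
      refine ⟨F, h1, h2, h3, fun s y hy => ?_⟩
      have hs := T.alg.two_le s
      have hd := totdeg_cons D dg s y
      have hv0 : v (cons s y) = 0 := by
        by_contra h0
        have := hv _ h0
        omega
      have ht0 : transp D f g F (cons s y) = 0 := by
        by_contra h0
        have := T.transp_deg h1 _ h0
        omega
      simp [hv0, ht0]
    | succ k ih =>
      obtain ⟨F, h1, h2, h3, h4⟩ := ih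
      by_cases hk : k + 2 ≤ n
      · exact T.step_lift hv (j := n - 1 - (k + 1)) (by omega) h1 h2 h3
          fun s y hy => h4 s y (by omega)
      · exact ⟨F, h1, h2, h3, fun s y hy => h4 s y (by omega)⟩
  obtain ⟨F, h1, h2, h3, h4⟩ := key n
  exact ⟨F, h1, h2, h3, fun s y => h4 s y (by omega)⟩

/-- On functions supported on `U` only the constant terms of `g` count, and these are the
differential of the module resolution. -/
theorem transp_one {r : FreeMonoid S × U → Q} (hr : ∀ s y, r (cons s y) = 0) (u : U) :
    transp D f g r (1, u) = ∑ u', e u' u * r (1, u') := by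
  rw [transp, pair_apply, total_bas_one]
  refine Finset.sum_congr rfl fun u' _ => ?_
  rw [extend_apply, ← T.g_lin]
  rw [Finsupp.sum, Finset.sum_eq_single 1]
  · rfl
  · intro w _ hw
    rcases word_cases (w, u') with ⟨u, hu⟩ | ⟨s, y, hy⟩
    · exact absurd (congrArg Prod.fst hu) hw
    · rw [hy, hr, smul_zero]
  · intro hw
    rw [Finsupp.notMem_support_iff.1 hw, zero_smul]

/-- Exactness of the transposed complex, up to the ideal `(h)`. -/
theorem exact {v : FreeMonoid S × U → Q} {n : ℕ} (hv : ∀ x, v x ≠ 0 → totdeg D dg x = n)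
    (hI : ∀ y, transp D f g v y ∈ Ideal.span (Set.range h))
    (hgen : ∑ u, v (1, u) • gen u = 0) :
    ∃ F : FreeMonoid S × U → Q, (∀ x, F x ≠ 0 → totdeg D dg x = n + 1) ∧ transp D f g F = v := by
  obtain ⟨F, h1, h2, h3, h4⟩ := T.exists_lift hv hI
  set r := v - transp D f g F with hrdef
  have htr : transp D f g r = 0 := by
    rw [hrdef, transp_sub]
    funext y
    simp [T.transp_transp, h3]
  have hrn : ∀ x, r x ≠ 0 → totdeg D dg x = n := by
    intro x hx
    by_cases hvx : v x = 0
    · have : transp D f g F x ≠ 0 := by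
        intro h0
        exact hx (by simp [r, hvx, h0])
      have := T.transp_deg h1 x this
      omega
    · exact hv x hvx
  have hrgen : ∑ u, r (1, u) • gen u = 0 := by
    -- For `dg u = 0` the value involves `F` in degree 1. There no word has a letter, and `F`
    -- vanishes on `U` by construction.
    have h5 : ∀ u, transp D f g F (1, u) • gen u = 0 := by
      intro u
      by_cases hu : gen u = 0
      · simp [hu]
      · have hu0 := T.mod.gen_deg u hu
        have : transp D f g F (1, u) = 0 := by
          refine transp_eq_zero T.f_mem T.g_mem fun x hx => ?_
          rcases word_cases x with ⟨u', rfl⟩ | ⟨s, y, rfl⟩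
          · exact h2 u'
          · have := T.alg.two_le s
            rw [totdeg_cons] at hx
            simp only [totdeg, wdeg_one] at hx
            omega
        rw [this, zero_smul]
    simp [r, sub_smul, h5, hgen]
  obtain ⟨w, hw1, hw2⟩ := T.mod.exact n (fun u => r (1, u))
    (fun u hu => by simpa [totdeg] using hrn _ hu) ⟨fun u => by
      have := T.transp_one h4 u
      rw [htr, Pi.zero_apply] at this
      rw [this]
      exact Finset.sum_congr rfl fun _ _ => mul_comm _ _, hrgen⟩
  -- The remaining error lives on `U` and is a cycle of the module resolution, so it is corrected by
  -- a function on `U` alone.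
  let G : FreeMonoid S × U → Q := fun x => if x.1.toList = [] then - w x.2 else 0
  have hG0 : ∀ s y, G (cons s y) = 0 := fun s y => rfl
  have hG1 : ∀ u, G (1, u) = - w u := fun u => rfl
  refine ⟨F - G, fun x hx => ?_, ?_⟩
  · rcases word_cases x with ⟨u, rfl⟩ | ⟨s, y, rfl⟩
    · simp only [Pi.sub_apply, h2, hG1, zero_sub, neg_neg] at hx
      simpa [totdeg] using hw1 u hx
    · simp only [Pi.sub_apply, hG0, sub_zero] at hx
      exact h1 _ hx
  · rw [transp_sub]
    funext x
    rcases word_cases x with ⟨u, rfl⟩ | ⟨s, y, rfl⟩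
    · have h5 := T.transp_one hG0 u
      have h6 := hw2 u
      simp only [hG1] at h5
      have h7 : r (1, u) = v (1, u) - transp D f g F (1, u) := rfl
      have h8 : ∑ u', e u' u * -w u' = - r (1, u) := by
        rw [← h6, ← Finset.sum_neg_distrib]
        exact Finset.sum_congr rfl fun _ _ => by ring
      rw [Pi.sub_apply, h5, h8, h7]
      ring
    · have h5 : transp D f g G (cons s y) = ∑ s', d s' s * G (cons s' y) :=
        T.leading (fun s y' _ => hG0 s y') s
      have h6 : v (cons s y) - transp D f g F (cons s y) = 0 := h4 s y
      simp only [hG0, mul_zero, Finset.sum_const_zero] at h5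
      rw [Pi.sub_apply, h5, sub_zero]
      exact (sub_eq_zero.1 h6).symm

end IsTwisting

end Exactness


/-! ### Computing Tor from a resolution given by matrices. -/

section ResidueTor

open IsLocalRing

theorem finrank_range_extendScalars {R k : Type u} [CommRing R] [Field k] (φ : R →+* k)
    {m n : Type} [Fintype m] [Fintype n] (B : Matrix m n R) :
    Module.finrank k (LinearMap.range ((ModuleCat.extendScalars.{u, u, u} φ).map
      (ModuleCat.ofHom B.mulVecLin)).hom) = (B.map φ).rank := by
  classical
  let _ := φ.toAlgebra
  change Module.finrank k (LinearMap.range (LinearMap.baseChange k B.mulVecLin)) = _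
  have h := LinearMap.toMatrix_baseChange k B.mulVecLin (Pi.basisFun R n) (Pi.basisFun R m)
  have h2 : LinearMap.toMatrix (Pi.basisFun R n) (Pi.basisFun R m) B.mulVecLin = B := by
    rw [← Matrix.toLin'_apply', ← Matrix.toLin_eq_toLin', LinearMap.toMatrix_toLin]
  rw [h2] at h
  rw [show B.map φ = B.map (algebraMap R k) from rfl, ← h]
  rw [Matrix.rank_eq_finrank_range_toLin _ (Algebra.TensorProduct.basis k (Pi.basisFun R m))
    (Algebra.TensorProduct.basis k (Pi.basisFun R n)), Matrix.toLin_toMatrix]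

theorem finrank_extendScalars {R k : Type u} [CommRing R] [Field k] (φ : R →+* k)
    (n : Type) [Fintype n] :
    Module.finrank k ((ModuleCat.extendScalars.{u, u, u} φ).obj (ModuleCat.of R (n → R))) =
      Fintype.card n ∧ Module.Finite k
        ((ModuleCat.extendScalars.{u, u, u} φ).obj (ModuleCat.of R (n → R))) := by
  classical
  let _ := φ.toAlgebra
  exact ⟨Module.finrank_eq_card_basis (Algebra.TensorProduct.basis k (Pi.basisFun R n)),
    Module.Finite.of_basis (Algebra.TensorProduct.basis k (Pi.basisFun R n))⟩

theorem finrank_homology {k : Type u} [Field k] (S : ShortComplex (ModuleCat.{u} k))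
    [Module.Finite k S.X₂] :
    Module.finrank k S.homology + Module.finrank k (LinearMap.range S.f.hom) +
      Module.finrank k (LinearMap.range S.g.hom) = Module.finrank k S.X₂ := by
  have h1 : Module.finrank k S.homology = Module.finrank k
      (LinearMap.ker S.g.hom ⧸ LinearMap.range S.moduleCatToCycles) :=
    S.moduleCatHomologyIso.toLinearEquiv.finrank_eq
  have h2 := Submodule.finrank_quotient_add_finrank (LinearMap.range S.moduleCatToCycles)
  have h3 := LinearMap.finrank_range_add_finrank_ker S.g.hom
  have h4 : Module.finrank k (LinearMap.range S.moduleCatToCycles) =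
      Module.finrank k (LinearMap.range S.f.hom) := by
    rw [← LinearMap.finrank_range_of_inj (f := (LinearMap.ker S.g.hom).subtype ∘ₗ
      (LinearMap.range S.moduleCatToCycles).subtype)
      (Subtype.val_injective.comp Subtype.val_injective), LinearMap.range_comp,
      Submodule.range_subtype, ← LinearMap.range_comp]
    rfl
  omega

variable {R : Type u} [CommRing R] {M : Type u} [AddCommGroup M] [Module R M]
  {ι : ℕ → Type} [∀ n, Fintype (ι n)]

/-- A resolution of `M` by finite free modules, given by matrices. -/
structure IsFreeResolution (B : ∀ n, Matrix (ι n) (ι (n + 1)) R) (aug : (ι 0 → R) →ₗ[R] M) :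
    Prop where
  surj : Function.Surjective aug
  aug_mul : ∀ v, aug ((B 0).mulVec v) = 0
  aug_exact : ∀ v, aug v = 0 → ∃ w, (B 0).mulVec w = v
  mul_mul : ∀ n v, (B n).mulVec ((B (n + 1)).mulVec v) = 0
  exact : ∀ n v, (B n).mulVec v = 0 → ∃ w, (B (n + 1)).mulVec w = v

namespace IsFreeResolution

variable {B : ∀ n, Matrix (ι n) (ι (n + 1)) R} {aug : (ι 0 → R) →ₗ[R] M}
  (h : IsFreeResolution B aug)

/-- The chain complex of a resolution by matrices. -/
noncomputable def complex (h : IsFreeResolution B aug) : ChainComplex (ModuleCat.{u} R) ℕ :=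
  ChainComplex.of (fun n => ModuleCat.of R (ι n → R)) (fun n => ModuleCat.ofHom (B n).mulVecLin)
    fun n => by
      ext v : 2
      exact h.mul_mul n v

theorem complex_d (n : ℕ) :
    h.complex.d (n + 1) n = ModuleCat.ofHom (B n).mulVecLin := by
  exact ChainComplex.of_d (fun n => ModuleCat.of R (ι n → R))
    (fun n => ModuleCat.ofHom (B n).mulVecLin) n

/-- The projective resolution of a resolution by matrices. -/
noncomputable def resolution (h : IsFreeResolution B aug) :
    ProjectiveResolution (ModuleCat.of R M) where
  complex := h.complex
  projective n := by
    change Projective (ModuleCat.of R (ι n → R))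
    infer_instance
  π := (ChainComplex.toSingle₀Equiv _ _).symm ⟨ModuleCat.ofHom aug, by
    rw [complex_d]
    ext v : 2
    exact h.aug_mul v⟩
  quasiIso := ⟨fun n => by
    cases n with
    | zero =>
      rw [ChainComplex.quasiIsoAt₀_iff, ShortComplex.quasiIso_iff_of_zeros']
      · have h1 : (ShortComplex.mk (h.complex.d 1 0) (ModuleCat.ofHom aug) (by
            rw [complex_d]
            ext v : 2
            exact h.aug_mul v)).Exact := by
          rw [ShortComplex.moduleCat_exact_iff]
          intro v hv
          obtain ⟨w, hw⟩ := h.aug_exact v hv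
          refine ⟨w, ?_⟩
          simp only [complex_d]
          exact hw
        have h2 : Epi (ModuleCat.ofHom aug) := (ModuleCat.epi_iff_surjective _).2 h.surj
        have h3 : ((ChainComplex.toSingle₀Equiv h.complex (ModuleCat.of R M)).symm
            ⟨ModuleCat.ofHom aug, by
              rw [complex_d]
              ext v : 2
              exact h.aug_mul v⟩).f 0 = ModuleCat.ofHom aug :=
          ChainComplex.toSingle₀Equiv_symm_apply_f_zero _ _
        refine (ShortComplex.exact_and_epi_g_iff_of_iso ?_).2 ⟨h1, h2⟩
        exact ShortComplex.isoMk (Iso.refl _) (Iso.refl _) (Iso.refl _)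
          ((Category.id_comp _).trans (Category.comp_id _).symm)
          ((Category.id_comp _).trans (h3.symm.trans (Category.comp_id _).symm))
      all_goals rfl
    | succ n =>
      rw [quasiIsoAt_iff_exactAt']
      · rw [HomologicalComplex.exactAt_iff' _ (n + 2) (n + 1) n (by simp) (by simp),
          ShortComplex.moduleCat_exact_iff]
        intro v hv
        change (h.complex.d (n + 1) n) v = 0 at hv
        rw [complex_d] at hv
        obtain ⟨w, hw⟩ := h.exact n v hv
        refine ⟨w, ?_⟩
        change (h.complex.d (n + 2) (n + 1)) w = v
        rw [complex_d]
        exact hw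
      · apply ChainComplex.exactAt_succ_single_obj⟩

variable [IsLocalRing R]

/-- The complex computing `residueTor`. -/
noncomputable def residueComplex (h : IsFreeResolution B aug) :
    ChainComplex (ModuleCat.{u} (ResidueField R)) ℕ :=
  ((ModuleCat.extendScalars.{u, u, u} (residue R)).mapHomologicalComplex _).obj h.complex

theorem residueComplex_d (n : ℕ) : h.residueComplex.d (n + 1) n =
    (ModuleCat.extendScalars.{u, u, u} (residue R)).map (ModuleCat.ofHom (B n).mulVecLin) :=
  congrArg (ModuleCat.extendScalars.{u, u, u} (residue R)).map (h.complex_d n)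

theorem finrank_residueComplex_X (n : ℕ) :
    Module.finrank (ResidueField R) (h.residueComplex.X n) = Fintype.card (ι n) ∧
      Module.Finite (ResidueField R) (h.residueComplex.X n) :=
  finrank_extendScalars (residue R) (ι n)

theorem finrank_range_residueComplex_d (n : ℕ) :
    Module.finrank (ResidueField R) (LinearMap.range (h.residueComplex.d (n + 1) n).hom) =
      ((B n).map (residue R)).rank := by
  rw [residueComplex_d]
  exact finrank_range_extendScalars (residue R) (B n)

theorem finrank_residueTor (n : ℕ) : Module.finrank (ResidueField R) (residueTor R M n) =
    Module.finrank (ResidueField R) (h.residueComplex.homology n) :=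
  (h.resolution.isoLeftDerivedObj
    (ModuleCat.extendScalars.{u, u, u} (residue R)) n).toLinearEquiv.finrank_eq

theorem finrank_residueTor_zero (h : IsFreeResolution B aug) :
    Module.finrank (ResidueField R) (residueTor R M 0) + ((B 0).map (residue R)).rank =
      Fintype.card (ι 0) := by
  have h0 := h.finrank_residueTor 0
  have h1 := (h.residueComplex.homologyIsoSc' 1 0 0 (by simp) (by simp)).toLinearEquiv.finrank_eq
  have : Module.Finite (ResidueField R) (h.residueComplex.sc' 1 0 0).X₂ :=
    (h.finrank_residueComplex_X 0).2
  have h2 := finrank_homology (h.residueComplex.sc' 1 0 0)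
  have h3 : (h.residueComplex.sc' 1 0 0).g = 0 := h.residueComplex.shape 0 0 (by simp)
  have h4 : Module.finrank (ResidueField R) (LinearMap.range (h.residueComplex.sc' 1 0 0).g.hom)
      = 0 := by
    rw [LinearMap.range_eq_bot.2 (congrArg ModuleCat.Hom.hom h3)]
    exact finrank_bot _ _
  have h5 := h.finrank_range_residueComplex_d 0
  have h6 := (h.finrank_residueComplex_X 0).1
  rw [h4, ← h1, ← h0, add_zero] at h2
  rw [← h5, ← h6]
  exact h2

/-- Rank-nullity for the reduced complex. It turns equality of a Tor dimension with the rank of the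
free module into vanishing of both adjacent reduced matrices. -/
theorem finrank_residueTor_succ (h : IsFreeResolution B aug) (n : ℕ) :
    Module.finrank (ResidueField R) (residueTor R M (n + 1)) +
      ((B (n + 1)).map (residue R)).rank + ((B n).map (residue R)).rank =
      Fintype.card (ι (n + 1)) := by
  have h0 := h.finrank_residueTor (n + 1)
  have h1 := (h.residueComplex.homologyIsoSc' (n + 2) (n + 1) n (by simp)
    (by simp)).toLinearEquiv.finrank_eq
  have : Module.Finite (ResidueField R) (h.residueComplex.sc' (n + 2) (n + 1) n).X₂ :=
    (h.finrank_residueComplex_X (n + 1)).2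
  have h2 := finrank_homology (h.residueComplex.sc' (n + 2) (n + 1) n)
  rw [← h1, ← h0] at h2
  rw [← h.finrank_range_residueComplex_d (n + 1), ← h.finrank_range_residueComplex_d n,
    ← (h.finrank_residueComplex_X (n + 1)).1]
  exact h2

end IsFreeResolution

end ResidueTor


/-! ### Existence and length of minimal free resolutions. -/

section MinimalResolution

open IsLocalRing

/-- A finite module over a local ring has a generating family without unit relations. -/
theorem exists_minimal_family {Q N : Type*} [CommRing Q] [IsLocalRing Q] [AddCommGroup N]
    [Module Q N] (K : Submodule Q N) (hK : K.FG) :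
    ∃ (r : ℕ) (g : Fin r → N), Submodule.span Q (Set.range g) = K ∧
      ∀ v : Fin r → Q, ∑ i, v i • g i = 0 → ∀ i, v i ∈ maximalIdeal Q := by
  classical
  have hex : ∃ (r : ℕ) (g : Fin r → N), Submodule.span Q (Set.range g) = K :=
    Submodule.fg_iff_exists_fin_generating_family.1 hK
  obtain ⟨g, hg⟩ := Nat.find_spec hex
  refine ⟨Nat.find hex, g, hg, fun v hv i => ?_⟩
  by_contra hi
  rw [mem_maximalIdeal, mem_nonunits_iff, not_not] at hi
  have hmin := fun r h => Nat.find_min hex (m := r) h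
  generalize Nat.find hex = r at g hg v hv i hi hmin
  cases r with
  | zero => exact i.elim0
  | succ r =>
    -- A unit coefficient at `i` expresses that generator through the others, against the minimality
    -- of their number.
    refine hmin r (Nat.lt_succ_self r) ⟨g ∘ i.succAbove, le_antisymm ?_ ?_⟩
    · rw [← hg]
      exact Submodule.span_mono (Set.range_comp_subset_range _ _)
    · rw [← hg, Submodule.span_le]
      rintro _ ⟨j, rfl⟩
      rcases Fin.eq_self_or_eq_succAbove i j with rfl | ⟨k, rfl⟩
      · rw [Fin.sum_univ_succAbove _ j] at hv
        obtain ⟨a, ha⟩ := hi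
        have h : g j = -(∑ k, (↑a⁻¹ * v (j.succAbove k)) • g (j.succAbove k)) := by
          have h2 := congrArg (fun x => (↑a⁻¹ : Q) • x) (eq_neg_of_add_eq_zero_left hv)
          simp only [← ha, smul_smul, Units.inv_mul, one_smul, smul_neg, Finset.smul_sum] at h2
          exact h2
        rw [h]
        exact neg_mem (sum_mem fun k _ => Submodule.smul_mem _ _ (Submodule.subset_span ⟨k, rfl⟩))
      · exact Submodule.subset_span ⟨k, rfl⟩

variable {Q : Type u} [CommRing Q] [IsLocalRing Q]

/-- A family of matrices is minimal if all its entries are nonunits. -/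
def IsMinimal {ι : ℕ → Type} (B : ∀ n, Matrix (ι n) (ι (n + 1)) Q) : Prop :=
  ∀ n i j, B n i j ∈ maximalIdeal Q

/-- A minimal cover of a projective module is an isomorphism. -/
theorem injective_of_minimal_cover {ι : Type} [Fintype ι] {M : Type u} [AddCommGroup M]
    [Module Q M] [Module.Projective Q M] (aug : (ι → Q) →ₗ[Q] M) (hs : Function.Surjective aug)
    (hm : ∀ v, aug v = 0 → ∀ i, v i ∈ maximalIdeal Q) : Function.Injective aug := by
  classical
  obtain ⟨s, hs⟩ := Module.projective_lifting_property aug LinearMap.id hs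
  have hs' : ∀ x, aug (s x) = x := fun x => LinearMap.congr_fun hs x
  -- Nakayama: the kernel lies in the maximal ideal times the free module, so the section `s` is
  -- onto.
  have htop : (⊤ : Submodule Q (ι → Q)) ≤ LinearMap.range s := by
    refine Submodule.le_of_le_smul_of_le_jacobson_bot (I := maximalIdeal Q) Module.Finite.fg_top
      (maximalIdeal_le_jacobson ⊥) fun v _ => ?_
    have h : v = s (aug v) + (v - s (aug v)) := by abel
    rw [h]
    refine Submodule.add_mem_sup (LinearMap.mem_range_self _ _) ?_
    have h2 := hm (v - s (aug v)) (by rw [map_sub, hs', sub_self])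
    rw [pi_eq_sum_univ' (v - s (aug v))]
    exact sum_mem fun i _ => Submodule.smul_mem_smul (h2 i) trivial
  intro v w hvw
  obtain ⟨x, rfl⟩ := htop (trivial : v ∈ _)
  obtain ⟨y, rfl⟩ := htop (trivial : w ∈ _)
  rw [hs', hs'] at hvw
  rw [hvw]

section

variable {ι : ℕ → Type} [∀ n, Fintype (ι n)] {B : ∀ n, Matrix (ι n) (ι (n + 1)) Q}

theorem IsMinimal.mulVec_mem (hB : IsMinimal B) (n : ℕ) (v : ι (n + 1) → Q) (i : ι n) :
    (B n).mulVec v i ∈ maximalIdeal Q :=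
  sum_mem fun j _ => Ideal.mul_mem_right _ _ (hB n i j)

theorem IsMinimal.map_eq_zero {ι : ℕ → Type} {B : ∀ n, Matrix (ι n) (ι (n + 1)) Q}
    (hB : IsMinimal B) (n : ℕ) : (B n).map (residue Q) = 0 := by
  ext i j
  exact (residue_eq_zero_iff _).2 (hB n i j)

/-- A basis vector in the image of a minimal matrix would put 1 in the maximal ideal. -/
theorem IsMinimal.isEmpty_of_forall (hB : IsMinimal B)
    (n : ℕ) (hx : ∀ v : ι n → Q, ∃ w, (B n).mulVec w = v) : IsEmpty (ι n) := by
  classical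
  refine ⟨fun i => ?_⟩
  obtain ⟨w, hw⟩ := hx (Pi.single i 1)
  have h := hB.mulVec_mem n w i
  rw [hw, Pi.single_eq_same] at h
  exact (Ideal.ne_top_iff_one _).1 (maximalIdeal.isMaximal Q).ne_top h

theorem IsFreeResolution.finrank_residueTor_of_isMinimal {M : Type u} [AddCommGroup M]
    [Module Q M] {aug : (ι 0 → Q) →ₗ[Q] M} (h : IsFreeResolution B aug) (hB : IsMinimal B)
    (n : ℕ) : Module.finrank (ResidueField Q) (residueTor Q M n) = Fintype.card (ι n) := by
  cases n with
  | zero =>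
    have h1 := h.finrank_residueTor_zero
    rwa [hB.map_eq_zero, Matrix.rank_zero, add_zero] at h1
  | succ n =>
    have h1 := h.finrank_residueTor_succ n
    rwa [hB.map_eq_zero, hB.map_eq_zero, Matrix.rank_zero, Matrix.rank_zero, add_zero,
      add_zero] at h1

end

/-- The shift of a free resolution resolves the first syzygy. -/
theorem IsFreeResolution.shift {Q : Type u} [CommRing Q] {ι : ℕ → Type} [∀ n, Fintype (ι n)]
    {B : ∀ n, Matrix (ι n) (ι (n + 1)) Q} {M : Type u} [AddCommGroup M] [Module Q M]
    {aug : (ι 0 → Q) →ₗ[Q] M} (h : IsFreeResolution B aug) :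
    IsFreeResolution (ι := fun n => ι (n + 1)) (fun n => B (n + 1))
      ((B 0).mulVecLin.codRestrict (LinearMap.ker aug) h.aug_mul) where
  surj v := by
    obtain ⟨w, hw⟩ := h.aug_exact v v.2
    exact ⟨w, Subtype.ext hw⟩
  aug_mul v := Subtype.ext (h.mul_mul 0 v)
  aug_exact v hv := h.exact 0 v (congrArg Subtype.val hv)
  mul_mul n v := h.mul_mul (n + 1) v
  exact n v hv := h.exact (n + 1) v hv

/-- A minimal free resolution vanishes beyond the projective dimension. -/
theorem IsFreeResolution.isEmpty_of_hasProjectiveDimensionLT (n : ℕ) :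
    ∀ {ι : ℕ → Type} [∀ n, Fintype (ι n)] {B : ∀ n, Matrix (ι n) (ι (n + 1)) Q} {M : Type u}
      [AddCommGroup M] [Module Q M] {aug : (ι 0 → Q) →ₗ[Q] M} (_ : IsFreeResolution B aug)
      (_ : IsMinimal B) (_ : HasProjectiveDimensionLT (ModuleCat.of Q M) (n + 1)),
      IsEmpty (ι (n + 1)) := by
  induction n with
  | zero =>
    intro ι _ B M _ _ aug h hB hp
    have h1 : Projective (ModuleCat.of Q M) := inferInstance
    have : Module.Projective Q M := (IsProjective.iff_projective _).2 h1
    have hinj := injective_of_minimal_cover aug h.surj fun v hv i => by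
      obtain ⟨w, rfl⟩ := h.aug_exact v hv
      exact hB.mulVec_mem 0 w i
    refine hB.isEmpty_of_forall 1 fun v => h.exact 0 v (hinj ?_)
    rw [h.aug_mul, map_zero]
  | succ n ih =>
    intro ι _ B M _ _ aug h hB hp
    refine ih h.shift (fun m => hB (m + 1)) ?_
    -- Dimension shifting: the first syzygy has projective dimension one less and is resolved by the
    -- shifted matrices.
    have hS : (ShortComplex.mk (ModuleCat.ofHom (LinearMap.ker aug).subtype)
        (ModuleCat.ofHom aug) (by ext v : 2; exact v.2)).ShortExact := by
      have hm : Mono (ModuleCat.ofHom (LinearMap.ker aug).subtype) :=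
        (ModuleCat.mono_iff_injective _).2 Subtype.val_injective
      have he : Epi (ModuleCat.ofHom aug) := (ModuleCat.epi_iff_surjective _).2 h.surj
      refine ShortComplex.ShortExact.mk ?_
      rw [ShortComplex.moduleCat_exact_iff]
      intro v hv
      exact ⟨⟨v, hv⟩, rfl⟩
    exact (hS.hasProjectiveDimensionLT_X₃_iff n
      (inferInstanceAs (Projective (ModuleCat.of Q (ι 0 → Q))))).1 hp

variable [IsNoetherianRing Q]

theorem exists_minimal_matrix (K : Σ r : ℕ, Submodule Q (Fin r → Q)) :
    ∃ (r : ℕ) (B : Matrix (Fin K.1) (Fin r) Q), LinearMap.range B.mulVecLin = K.2 ∧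
      ∀ v, B.mulVec v = 0 → ∀ i, v i ∈ maximalIdeal Q := by
  obtain ⟨r, g, hg, h⟩ := exists_minimal_family K.2 (IsNoetherian.noetherian _)
  refine ⟨r, Matrix.of fun i j => g j i, ?_, fun v hv => h v ?_⟩
  · rw [Matrix.range_mulVecLin, ← hg]
    rfl
  · rw [← hv, Matrix.mulVec_eq_sum]
    exact Finset.sum_congr rfl fun i _ => (op_smul_eq_smul (v i) (g i)).symm

/-- The iterated syzygies of a submodule of a free module, in a minimal free resolution. -/
noncomputable def syzygy (K : Σ r : ℕ, Submodule Q (Fin r → Q)) :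
    ℕ → Σ r : ℕ, Submodule Q (Fin r → Q)
  | 0 => K
  | n + 1 => ⟨(exists_minimal_matrix (syzygy K n)).choose,
      LinearMap.ker (exists_minimal_matrix (syzygy K n)).choose_spec.choose.mulVecLin⟩

/-- The differentials of a minimal free resolution. -/
noncomputable def minimalMatrix (K : Σ r : ℕ, Submodule Q (Fin r → Q)) (n : ℕ) :
    Matrix (Fin (syzygy K n).1) (Fin (syzygy K (n + 1)).1) Q :=
  (exists_minimal_matrix (syzygy K n)).choose_spec.choose

theorem range_minimalMatrix (K : Σ r : ℕ, Submodule Q (Fin r → Q)) (n : ℕ) :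
    LinearMap.range (minimalMatrix K n).mulVecLin = (syzygy K n).2 :=
  (exists_minimal_matrix (syzygy K n)).choose_spec.choose_spec.1

theorem mulVec_minimalMatrix_mem (K : Σ r : ℕ, Submodule Q (Fin r → Q)) (n : ℕ)
    (v : Fin (syzygy K (n + 1)).1 → Q) : (minimalMatrix K n).mulVec v ∈ (syzygy K n).2 := by
  rw [← range_minimalMatrix]
  exact LinearMap.mem_range_self (minimalMatrix K n).mulVecLin v

theorem exists_mulVec_minimalMatrix (K : Σ r : ℕ, Submodule Q (Fin r → Q)) (n : ℕ)
    (v : Fin (syzygy K n).1 → Q) (hv : v ∈ (syzygy K n).2) :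
    ∃ w, (minimalMatrix K n).mulVec w = v := by
  rw [← range_minimalMatrix] at hv
  exact hv

theorem mem_of_mem_syzygy (K : Σ r : ℕ, Submodule Q (Fin r → Q))
    (hK : ∀ v ∈ K.2, ∀ i, v i ∈ maximalIdeal Q) (n : ℕ) (v : Fin (syzygy K n).1 → Q)
    (hv : v ∈ (syzygy K n).2) (i : Fin (syzygy K n).1) : v i ∈ maximalIdeal Q := by
  cases n with
  | zero => exact hK v hv i
  | succ n => exact (exists_minimal_matrix (syzygy K n)).choose_spec.choose_spec.2 v hv i

theorem isMinimal_minimalMatrix (K : Σ r : ℕ, Submodule Q (Fin r → Q))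
    (hK : ∀ v ∈ K.2, ∀ i, v i ∈ maximalIdeal Q) :
    IsMinimal (ι := fun n => Fin (syzygy K n).1) (minimalMatrix K) := by
  classical
  intro n i j
  have h : (minimalMatrix K n).mulVecLin (Pi.single j 1) ∈ (syzygy K n).2 := by
    rw [← range_minimalMatrix]
    exact LinearMap.mem_range_self _ _
  have h2 := mem_of_mem_syzygy K hK n _ h i
  rwa [Matrix.mulVecLin_apply, Matrix.mulVec_single_one, Matrix.col_apply] at h2

theorem isFreeResolution_minimalMatrix {M : Type u} [AddCommGroup M] [Module Q M] (r : ℕ)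
    (aug : (Fin r → Q) →ₗ[Q] M) (haug : Function.Surjective aug) :
    IsFreeResolution (ι := fun n => Fin (syzygy ⟨r, LinearMap.ker aug⟩ n).1)
      (minimalMatrix ⟨r, LinearMap.ker aug⟩) aug where
  surj := haug
  aug_mul := mulVec_minimalMatrix_mem ⟨r, LinearMap.ker aug⟩ 0
  aug_exact := exists_mulVec_minimalMatrix ⟨r, LinearMap.ker aug⟩ 0
  mul_mul n v := mulVec_minimalMatrix_mem ⟨r, LinearMap.ker aug⟩ (n + 1) v
  exact n v hv := exists_mulVec_minimalMatrix ⟨r, LinearMap.ker aug⟩ (n + 1) v hv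

/-- A finite module over a Noetherian local ring has a minimal free resolution. -/
theorem exists_minimal_resolution (M : Type u) [AddCommGroup M] [Module Q M] [Module.Finite Q M] :
    ∃ (r : ℕ → ℕ) (B : ∀ n, Matrix (Fin (r n)) (Fin (r (n + 1))) Q)
      (aug : (Fin (r 0) → Q) →ₗ[Q] M), IsFreeResolution (ι := fun n => Fin (r n)) B aug ∧
        IsMinimal (ι := fun n => Fin (r n)) B := by
  obtain ⟨r, g, hg, h⟩ := exists_minimal_family (⊤ : Submodule Q M) Module.Finite.fg_top
  have hs : Function.Surjective (Fintype.linearCombination Q g) := by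
    rw [← LinearMap.range_eq_top, Fintype.range_linearCombination, hg]
  exact ⟨_, _, _, isFreeResolution_minimalMatrix r _ hs, isMinimal_minimalMatrix _ h⟩

/-- A minimal free resolution of a nonzero cyclic algebra starts with the ring itself. -/
theorem exists_minimal_resolution_cyclic (R : Type u) [CommRing R] [Nontrivial R] [Algebra Q R]
    (hR : Function.Surjective (algebraMap Q R)) :
    ∃ (r : ℕ → ℕ) (B : ∀ n, Matrix (Fin (r n)) (Fin (r (n + 1))) Q)
      (aug : (Fin (r 0) → Q) →ₗ[Q] R), IsFreeResolution (ι := fun n => Fin (r n)) B aug ∧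
        IsMinimal (ι := fun n => Fin (r n)) B ∧
        ∃ i : Fin (r 0), (∀ j, j = i) ∧ ∀ v, aug v = algebraMap Q R (v i) := by
  refine ⟨_, _, _, isFreeResolution_minimalMatrix 1
    (Algebra.linearMap Q R ∘ₗ LinearMap.proj 0) ?_, isMinimal_minimalMatrix _ ?_, (0 : Fin 1),
    fun j => Subsingleton.elim (α := Fin 1) _ _, fun v => rfl⟩
  · intro y
    obtain ⟨x, rfl⟩ := hR y
    exact ⟨fun _ => x, rfl⟩
  · intro v hv i
    have hv' : algebraMap Q R (v 0) = 0 := hv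
    rw [Subsingleton.elim i 0]
    by_contra h
    rw [mem_maximalIdeal, mem_nonunits_iff, not_not] at h
    exact (h.map (algebraMap Q R)).ne_zero hv'

end MinimalResolution


/-! ### Length of minimal resolutions over a regular local ring. -/

section Regular

open IsLocalRing

/-- The quotient of a regular local ring by an element outside the square of the maximal ideal is
regular, of dimension one less. -/
theorem isRegularLocalRing_quotient {Q : Type u} [CommRing Q] [IsRegularLocalRing Q] {d : ℕ}
    (hd : ringKrullDim Q = (d + 1 : ℕ)) {x : Q} (hx : x ∈ maximalIdeal Q)
    (hx2 : x ∉ maximalIdeal Q * maximalIdeal Q) :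
    IsRegularLocalRing (Q ⧸ Ideal.span {x}) ∧ ringKrullDim (Q ⧸ Ideal.span {x}) = d := by
  classical
  have hfr : (maximalIdeal Q).spanFinrank = d + 1 := by
    have h := IsRegularLocalRing.spanFinrank_maximalIdeal (R := Q)
    rw [hd] at h
    exact_mod_cast h
  have hne : Ideal.span {x} ≠ ⊤ := fun h =>
    (maximalIdeal.isMaximal Q).ne_top (top_le_iff.1 (h ▸ (Ideal.span_singleton_le_iff_mem _).2 hx))
  have : Nontrivial (Q ⧸ Ideal.span {x}) := Ideal.Quotient.nontrivial_iff.2 hne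
  have hloc : IsLocalRing (Q ⧸ Ideal.span {x}) :=
    IsLocalRing.of_surjective' _ Ideal.Quotient.mk_surjective
  obtain ⟨s, hs, hspan⟩ := Submodule.FG.exists_span_finset_card_eq_spanFinrank
    (IsNoetherian.noetherian (maximalIdeal Q))
  rw [hfr] at hs
  have hxs : x ∈ Submodule.span Q (s : Set Q) := hspan ▸ hx
  obtain ⟨a, ha⟩ := (Submodule.mem_span_finset.1 hxs)
  -- Otherwise `x` would lie in the square of the maximal ideal. A unit coefficient at `y` lets `x`
  -- replace `y` in a minimal generating set, so `y` becomes superfluous modulo `x`.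
  have hu : ∃ y ∈ s, IsUnit (a y) := by
    by_contra! h
    refine hx2 (ha.2 ▸ sum_mem fun y hy => Ideal.mul_mem_mul (h y hy) ?_)
    exact hspan ▸ Submodule.subset_span hy
  obtain ⟨y, hy, u, hu⟩ := hu
  have hmap : maximalIdeal (Q ⧸ Ideal.span {x}) =
      Ideal.span ((s.erase y).image (Ideal.Quotient.mk (Ideal.span {x})) : Set _) := by
    rw [← map_maximalIdeal_of_surjective (Ideal.Quotient.mk (Ideal.span {x}))
      Ideal.Quotient.mk_surjective]
    refine le_antisymm ?_ ?_
    · have hmem : ∀ z ∈ s.erase y, z ∈ Ideal.comap (Ideal.Quotient.mk (Ideal.span {x}))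
          (Ideal.span ((s.erase y).image (Ideal.Quotient.mk (Ideal.span {x})) : Set _)) :=
        fun z hz => Ideal.subset_span (Finset.mem_coe.2 (Finset.mem_image_of_mem _ hz))
      have hy2 : y ∈ Ideal.comap (Ideal.Quotient.mk (Ideal.span {x}))
          (Ideal.span ((s.erase y).image (Ideal.Quotient.mk (Ideal.span {x})) : Set _)) := by
        have hxJ : x ∈ Ideal.comap (Ideal.Quotient.mk (Ideal.span {x}))
            (Ideal.span ((s.erase y).image (Ideal.Quotient.mk (Ideal.span {x})) : Set _)) := by
          rw [Ideal.mem_comap, Ideal.Quotient.eq_zero_iff_mem.2 (Ideal.mem_span_singleton_self x)]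
          exact zero_mem _
        have h2 := ha.2
        rw [← Finset.add_sum_erase s _ hy, ← hu, smul_eq_mul] at h2
        have h3 : y = ↑u⁻¹ * (x - ∑ z ∈ s.erase y, a z • z) := by
          rw [← h2, add_sub_cancel_right, Units.inv_mul_cancel_left]
        have h4 := Ideal.mul_mem_left _ (↑u⁻¹ : Q) (sub_mem hxJ
          (sum_mem fun z hz => Ideal.mul_mem_left _ (a z) (hmem z hz)))
        exact Set.mem_of_eq_of_mem h3 h4
      rw [Ideal.map_le_iff_le_comap, ← hspan]
      refine Submodule.span_le.2 fun z hz => ?_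
      by_cases hzy : z = y
      · exact hzy ▸ hy2
      · exact hmem z (Finset.mem_erase.2 ⟨hzy, hz⟩)
    · rw [Ideal.span_le]
      intro z hz
      obtain ⟨z, hz', rfl⟩ := Finset.mem_image.1 (Finset.mem_coe.1 hz)
      exact Ideal.mem_map_of_mem _ (hspan ▸ Submodule.subset_span (Finset.mem_of_mem_erase hz'))
  have hle : (maximalIdeal (Q ⧸ Ideal.span {x})).spanFinrank ≤ d := by
    rw [hmap]
    refine (Submodule.spanFinrank_span_le_ncard_of_finite (Finset.finite_toSet _)).trans ?_
    rw [Set.ncard_coe_finset]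
    refine Finset.card_image_le.trans ?_
    rw [Finset.card_erase_of_mem hy, hs, Nat.add_sub_cancel]
  have hge : (d : WithBot ℕ∞) ≤ ringKrullDim (Q ⧸ Ideal.span {x}) := by
    have h := Ideal.height_le_ringKrullDim_quotient_add_one hx
    rw [maximalIdeal_height_eq_ringKrullDim, hd] at h
    rw [Nat.cast_add, Nat.cast_one] at h
    exact ENat.WithBot.add_le_add_one_right_iff.1 h
  have hreg : IsRegularLocalRing (Q ⧸ Ideal.span {x}) :=
    IsRegularLocalRing.of_spanFinrank_maximalIdeal_le _ (le_trans (by exact_mod_cast hle) hge)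
  refine ⟨hreg, le_antisymm ?_ hge⟩
  rw [← hreg.spanFinrank_maximalIdeal]
  exact_mod_cast hle

theorem maximalIdeal_eq_bot_of_ringKrullDim_eq_zero {Q : Type u} [CommRing Q]
    [IsRegularLocalRing Q] (hd : ringKrullDim Q = (0 : ℕ)) : maximalIdeal Q = ⊥ := by
  have h := IsRegularLocalRing.spanFinrank_maximalIdeal (R := Q)
  rw [hd, Nat.cast_inj] at h
  exact (Submodule.spanFinrank_eq_zero_iff_eq_bot (IsNoetherian.noetherian _)).1 h

/-- Prime avoidance, which tolerates the nonprime ideal `m²`. The maximal ideal is not in `m²` by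
Nakayama, nor in a minimal prime because its height is positive. -/
theorem exists_parameter {Q : Type u} [CommRing Q] [IsRegularLocalRing Q] {d : ℕ}
    (hd : ringKrullDim Q = (d + 1 : ℕ)) : ∃ x ∈ maximalIdeal Q,
      x ∉ maximalIdeal Q * maximalIdeal Q ∧ ∀ p ∈ minimalPrimes Q, x ∉ p := by
  classical
  have hfin : (minimalPrimes Q).Finite := minimalPrimes.finite_of_isNoetherianRing Q
  by_contra! h
  have hsub : (maximalIdeal Q : Set Q) ⊆
      ⋃ i ∈ (↑(insert (maximalIdeal Q * maximalIdeal Q) hfin.toFinset) : Set (Ideal Q)),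
        ((i : Ideal Q) : Set Q) := by
    intro x hx
    simp only [Finset.coe_insert, Set.Finite.coe_toFinset, Set.mem_iUnion, Set.mem_insert_iff]
    by_cases h2 : x ∈ maximalIdeal Q * maximalIdeal Q
    · exact ⟨_, Or.inl rfl, h2⟩
    · obtain ⟨p, hp, hxp⟩ := h x hx h2
      exact ⟨p, Or.inr hp, hxp⟩
  rw [Ideal.subset_union_prime (maximalIdeal Q * maximalIdeal Q)
    (maximalIdeal Q * maximalIdeal Q)] at hsub
  · obtain ⟨i, hi, hle⟩ := hsub
    rw [Finset.mem_insert, Set.Finite.mem_toFinset] at hi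
    have hm0 : maximalIdeal Q ≠ ⊥ := by
      intro h0
      have h := IsRegularLocalRing.spanFinrank_maximalIdeal (R := Q)
      rw [h0, Submodule.spanFinrank_bot, hd, Nat.cast_inj] at h
      omega
    rcases hi with rfl | hi
    · exact hm0 (Submodule.eq_bot_of_le_smul_of_le_jacobson_bot (maximalIdeal Q) _
        (IsNoetherian.noetherian _) hle (maximalIdeal_le_jacobson ⊥))
    · have hip : i.IsPrime := hi.1.1
      have him : i = maximalIdeal Q := le_antisymm (le_maximalIdeal hip.ne_top) hle
      have h0 : (maximalIdeal Q).height = 0 := by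
        rw [Ideal.height_eq_zero_iff]
        exact him ▸ hi
      have h1 := maximalIdeal_height_eq_ringKrullDim (R := Q)
      rw [h0, hd] at h1
      exact absurd h1 (by norm_cast)
  · intro i hi hne _
    rw [Finset.mem_insert, Set.Finite.mem_toFinset] at hi
    exact (hi.resolve_left hne).1.1

/-- Regular local rings are domains. -/
theorem isDomain_of_isRegularLocalRing (d : ℕ) : ∀ {Q : Type u} [CommRing Q]
    [IsRegularLocalRing Q] (_ : ringKrullDim Q = (d : ℕ)), IsDomain Q := by
  induction d with
  | zero =>
    intro Q _ _ hd
    have h := isField_iff_maximalIdeal_eq.2 (maximalIdeal_eq_bot_of_ringKrullDim_eq_zero hd)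
    exact h.isDomain
  | succ d ih =>
    intro Q _ _ hd
    obtain ⟨x, hx, hx2, hp⟩ := exists_parameter hd
    obtain ⟨h1, h2⟩ := isRegularLocalRing_quotient hd hx hx2
    have h3 := ih h2
    have hprime : (Ideal.span {x}).IsPrime := (Ideal.Quotient.isDomain_iff_prime _).1 h3
    obtain ⟨p, hpm, hpx⟩ := Ideal.exists_minimalPrimes_le (I := ⊥) (J := Ideal.span {x}) bot_le
    have hpp : p.IsPrime := hpm.1.1
    -- Elements of `p` are multiples `z * x` with `x ∉ p`, so `z ∈ p` and `p` equals `x` times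
    -- itself; Nakayama gives zero.
    have hbot : p = ⊥ := by
      refine Submodule.eq_bot_of_le_smul_of_le_jacobson_bot (maximalIdeal Q) _
        (IsNoetherian.noetherian _) (fun y hy => ?_) (maximalIdeal_le_jacobson ⊥)
      obtain ⟨z, rfl⟩ := Ideal.mem_span_singleton'.1 (hpx hy)
      rw [mul_comm]
      exact Submodule.smul_mem_smul hx ((hpp.mem_or_mem hy).resolve_right (hp p hpm))
    rw [hbot] at hpp
    exact IsDomain.of_bot_isPrime Q

/-- Minimal exact sequences of finite free modules over a regular local ring vanish beyond the
dimension. -/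
theorem isEmpty_of_isRegularLocalRing (d : ℕ) : ∀ {Q : Type u} [CommRing Q]
    [IsRegularLocalRing Q] (_ : ringKrullDim Q = (d : ℕ)) {ι : ℕ → Type} [∀ n, Fintype (ι n)]
    {B : ∀ n, Matrix (ι n) (ι (n + 1)) Q} (_ : IsMinimal B)
    (_ : ∀ n v, (B n).mulVec ((B (n + 1)).mulVec v) = 0)
    (_ : ∀ n v, (B n).mulVec v = 0 → ∃ w, (B (n + 1)).mulVec w = v) (n : ℕ) (_ : d < n),
    IsEmpty (ι n) := by
  induction d with
  | zero =>
    intro Q _ _ hd ι _ B hB _ hex n hn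
    obtain ⟨n, rfl⟩ := Nat.exists_eq_succ_of_ne_zero hn.ne'
    refine hB.isEmpty_of_forall _ fun v => hex n v ?_
    ext i
    have h := hB.mulVec_mem n v i
    rw [maximalIdeal_eq_bot_of_ringKrullDim_eq_zero hd] at h
    exact h
  | succ d ih =>
    intro Q _ _ hd ι _ B hB h0 hex n hn
    obtain ⟨n, rfl⟩ := Nat.exists_eq_succ_of_ne_zero (Nat.ne_zero_of_lt hn)
    have hdom := isDomain_of_isRegularLocalRing (d + 1) hd
    obtain ⟨x, hx, hx2, hp⟩ := exists_parameter hd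
    have hx0 : x ≠ 0 := fun h => hx2 (h ▸ zero_mem _)
    obtain ⟨h1, h2⟩ := isRegularLocalRing_quotient hd hx hx2
    have hhom : IsLocalHom (Ideal.Quotient.mk (Ideal.span {x})) :=
      IsLocalHom.of_surjective _ Ideal.Quotient.mk_surjective
    have hmap : ∀ n (v : ι (n + 1) → Q), ((B n).map (Ideal.Quotient.mk (Ideal.span {x}))).mulVec
        (fun i => Ideal.Quotient.mk (Ideal.span {x}) (v i)) =
        fun i => Ideal.Quotient.mk (Ideal.span {x}) ((B n).mulVec v i) := by
      intro n v
      ext i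
      exact (RingHom.map_mulVec _ _ _ i).symm
    have hlift : ∀ n (v : ι n → Q ⧸ Ideal.span {x}), ∃ w : ι n → Q,
        v = fun i => Ideal.Quotient.mk (Ideal.span {x}) (w i) := by
      intro n v
      choose w hw using fun i => Ideal.Quotient.mk_surjective (v i)
      exact ⟨w, funext fun i => (hw i).symm⟩
    -- The sequence is reduced modulo the nonzerodivisor `x`. Exactness at a spot of the reduction
    -- uses the original sequence one spot lower, so one term is dropped, matching the drop in
    -- dimension.
    refine ih h2 (ι := fun n => ι (n + 1))
      (B := fun n => (B (n + 1)).map (Ideal.Quotient.mk (Ideal.span {x}))) ?_ ?_ ?_ n (by omega)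
    · intro n i j
      have h := hB (n + 1) i j
      rw [mem_maximalIdeal, mem_nonunits_iff] at h ⊢
      exact fun h' => h (isUnit_of_map_unit (Ideal.Quotient.mk (Ideal.span {x})) _ h')
    · intro n v
      obtain ⟨v, rfl⟩ := hlift _ v
      rw [hmap, hmap, h0]
      ext i
      exact map_zero _
    · intro n v hv
      obtain ⟨v, rfl⟩ := hlift _ v
      rw [hmap] at hv
      have h3 : ∀ i, ∃ z, z * x = (B (n + 1)).mulVec v i := fun i =>
        Ideal.mem_span_singleton'.1 (Ideal.Quotient.eq_zero_iff_mem.1 (congrFun hv i))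
      choose z hz using h3
      have hz' : (B (n + 1)).mulVec v = x • z := by
        ext i
        rw [← hz, Pi.smul_apply, smul_eq_mul, mul_comm]
      -- `x` times this vector is zero by `h0`, and `x` is a nonzerodivisor. Hence `z` is a
      -- boundary, and `v` differs from a cycle by a multiple of `x`.
      have h4 : (B n).mulVec z = 0 := by
        have h5 := h0 n v
        rw [hz', Matrix.mulVec_smul] at h5
        exact (smul_eq_zero.1 h5).resolve_left hx0
      obtain ⟨w, rfl⟩ := hex n z h4
      obtain ⟨t, ht⟩ := hex (n + 1) (v - x • w) (by
        rw [Matrix.mulVec_sub, Matrix.mulVec_smul, hz', sub_self])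
      refine ⟨fun i => Ideal.Quotient.mk (Ideal.span {x}) (t i), ?_⟩
      rw [hmap, ht]
      ext i
      rw [Ideal.Quotient.eq]
      refine Ideal.mem_span_singleton'.2 ⟨-w i, ?_⟩
      simp only [Pi.sub_apply, Pi.smul_apply, smul_eq_mul]
      ring

end Regular


/-! ### Gathering a sequence of matrices into one graded basis. -/

section Graded

theorem sum_sigma_eq {κ : ℕ → Type} [∀ n, Fintype (κ n)] [Fintype (Σ n, κ n)] {N : Type*}
    [AddCommMonoid N] (n : ℕ) {F : (Σ n, κ n) → N} (hF : ∀ m i, m ≠ n → F ⟨m, i⟩ = 0) :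
    ∑ u, F u = ∑ i, F ⟨n, i⟩ := by
  refine (Fintype.sum_of_injective (Sigma.mk n) sigma_mk_injective _ _ ?_ fun _ => rfl).symm
  rintro ⟨m, i⟩ hi
  refine hF m i ?_
  rintro rfl
  exact hi ⟨i, rfl⟩

variable {Q : Type u} [CommRing Q] {κ : ℕ → Type}

/-- The entry of the differential of a graded free module between two basis elements. -/
def sigmaEntry (B : ∀ n, Matrix (κ n) (κ (n + 1)) Q) (x y : Σ n, κ n) : Q :=
  if h : x.1 = y.1 + 1 then B y.1 y.2 (h ▸ x.2) else 0

theorem sigmaEntry_succ (B : ∀ n, Matrix (κ n) (κ (n + 1)) Q) (n : ℕ) (i : κ (n + 1)) (j : κ n) :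
    sigmaEntry B ⟨n + 1, i⟩ ⟨n, j⟩ = B n j i := dif_pos rfl

theorem sigmaEntry_deg (B : ∀ n, Matrix (κ n) (κ (n + 1)) Q) (x y : Σ n, κ n)
    (h : sigmaEntry B x y ≠ 0) : x.1 = y.1 + 1 := by
  by_contra hne
  exact h (dif_neg hne)

/-- A function on one degree, extended by zero. -/
def place (n : ℕ) (w : κ n → Q) (x : Σ n, κ n) : Q :=
  if h : x.1 = n then w (h ▸ x.2) else 0

theorem place_self (n : ℕ) (w : κ n → Q) (i : κ n) : place n w ⟨n, i⟩ = w i := dif_pos rfl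

theorem place_deg (n : ℕ) (w : κ n → Q) (x : Σ n, κ n) (h : place n w x ≠ 0) : x.1 = n := by
  by_contra hne
  exact h (dif_neg hne)

variable [∀ n, Fintype (κ n)] {M : Type u} [AddCommGroup M] [Module Q M]

open Classical in
/-- The augmentation on basis elements. -/
noncomputable def sigmaGen (aug : (κ 0 → Q) →ₗ[Q] M) : (Σ n, κ n) → M
  | ⟨0, i⟩ => aug (Pi.single i 1)
  | ⟨_ + 1, _⟩ => 0

theorem sum_smul_sigmaGen [Fintype (Σ n, κ n)] (aug : (κ 0 → Q) →ₗ[Q] M) (v : (Σ n, κ n) → Q) :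
    ∑ x, v x • sigmaGen aug x = aug fun i => v ⟨0, i⟩ := by
  classical
  rw [sum_sigma_eq 0]
  · conv_rhs => rw [pi_eq_sum_univ' fun i => v ⟨0, i⟩]
    rw [map_sum]
    refine Finset.sum_congr rfl fun i _ => ?_
    rw [map_smul]
    congr 2
  · rintro (_ | m) i hm
    · exact absurd rfl hm
    · exact smul_zero _

variable {B : ∀ n, Matrix (κ n) (κ (n + 1)) Q} {aug : (κ 0 → Q) →ₗ[Q] M}

theorem sum_mul_sigmaEntry [Fintype (Σ n, κ n)] (v : (Σ n, κ n) → Q) (n : ℕ) (j : κ n) :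
    ∑ x, v x * sigmaEntry B x ⟨n, j⟩ = (B n).mulVec (fun i => v ⟨n + 1, i⟩) j := by
  rw [sum_sigma_eq (n + 1)]
  · refine Finset.sum_congr rfl fun i _ => ?_
    rw [sigmaEntry_succ, mul_comm]
  · intro m i hm
    by_contra h
    exact hm (sigmaEntry_deg B _ _ (right_ne_zero_of_mul h))

theorem IsFreeResolution.isModuleResolution [Fintype (Σ n, κ n)] (h : IsFreeResolution B aug) :
    IsModuleResolution (fun x : Σ n, κ n => x.1) (sigmaEntry B) (sigmaGen aug) where
  d_deg := sigmaEntry_deg B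
  gen_deg := by
    rintro ⟨_ | n, i⟩ hu
    · rfl
    · exact absurd rfl hu
  d_d := by
    rintro u ⟨n, j⟩
    rw [sum_mul_sigmaEntry]
    have hz : ∀ w, (B n).mulVec w j = ∑ i, B n j i * w i := fun w => rfl
    by_cases hu : u.1 = n + 2
    · obtain ⟨m, k⟩ := u
      obtain rfl : m = n + 2 := hu
      classical
      have h2 := congrFun (h.mul_mul n (Pi.single k 1)) j
      rw [Matrix.mulVec_single_one] at h2
      refine Eq.trans ?_ h2
      congr 1
      funext i
      exact sigmaEntry_succ B _ _ _
    · rw [hz]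
      refine Finset.sum_eq_zero fun i _ => ?_
      by_contra h0
      exact hu (sigmaEntry_deg B _ _ (right_ne_zero_of_mul h0))
  d_gen := by
    intro u
    rw [sum_smul_sigmaGen]
    by_cases hu : u.1 = 1
    · obtain ⟨m, k⟩ := u
      obtain rfl : m = 1 := hu
      classical
      have h2 := h.aug_mul (Pi.single k 1)
      rw [Matrix.mulVec_single_one] at h2
      rw [← h2]
      congr 1
    · rw [← map_zero aug]
      congr 1
      funext i
      by_contra h0
      exact hu (sigmaEntry_deg B _ _ h0)
  exact := by
    rintro m v hv ⟨h1, h2⟩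
    suffices hw : ∃ w, (B m).mulVec w = fun i => v ⟨m, i⟩ by
      obtain ⟨w, hw⟩ := hw
      refine ⟨place (m + 1) w, place_deg _ _, ?_⟩
      rintro ⟨n, j⟩
      rw [sum_mul_sigmaEntry]
      by_cases hn : n = m
      · subst hn
        simp only [place_self]
        exact congrFun hw j
      · have hv0 : v ⟨n, j⟩ = 0 := by
          by_contra h0
          exact hn (hv _ h0)
        have hp : (fun i => place (m + 1) w ⟨n + 1, i⟩) = 0 := by
          funext i
          by_contra h0
          exact hn (Nat.succ_injective (place_deg _ _ _ h0))
        rw [hv0, hp, Matrix.mulVec_zero, Pi.zero_apply]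
    cases m with
    | zero =>
      rw [sum_smul_sigmaGen] at h2
      exact h.aug_exact _ h2
    | succ m =>
      refine h.exact m _ (funext fun j => ?_)
      rw [← sum_mul_sigmaEntry]
      exact h1 ⟨m, j⟩

/-- The positive part of a resolution of a cyclic algebra. -/
theorem IsFreeResolution.isCyclicResolution [Fintype (Σ n, κ (n + 1))] (h : IsFreeResolution B aug)
    {i₀ : κ 0} (hi : ∀ j, j = i₀) :
    IsCyclicResolution (fun x : Σ n, κ (n + 1) => x.1 + 2)
      (sigmaEntry (κ := fun n => κ (n + 1)) fun n => B (n + 1))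
      (fun x => (sigmaGen (κ := fun n => κ (n + 1))
        ((B 0).mulVecLin.codRestrict (LinearMap.ker aug) h.aug_mul) x).1 i₀) := by
  have hM := IsFreeResolution.isModuleResolution (κ := fun n => κ (n + 1)) h.shift
  have key : ∀ v : (Σ n, κ (n + 1)) → Q, ∑ s, v s * (sigmaGen (κ := fun n => κ (n + 1))
      ((B 0).mulVecLin.codRestrict (LinearMap.ker aug) h.aug_mul) s).1 i₀ = (∑ s, v s •
      sigmaGen (κ := fun n => κ (n + 1))
      ((B 0).mulVecLin.codRestrict (LinearMap.ker aug) h.aug_mul) s).1 i₀ := by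
    intro v
    rw [AddSubmonoidClass.coe_finsetSum, Finset.sum_apply]
    rfl
  refine ⟨fun s => Nat.le_add_left _ _, fun s s' hd => ?_, fun s hs => ?_, hM.d_d, fun s => ?_,
    fun m v hv hv' => ?_⟩
  · have := hM.d_deg s s' hd
    omega
  · have := hM.gen_deg s (by
      intro h0
      rw [h0] at hs
      exact hs rfl)
    omega
  · rw [key, hM.d_gen]
    rfl
  · by_cases hm : 2 ≤ m
    · obtain ⟨m, rfl⟩ := Nat.exists_eq_add_of_le' hm
      obtain ⟨w, hw, hw'⟩ := hM.exact m v (fun s hs => Nat.add_right_cancel (hv s hs))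
        ⟨hv'.1, by
          have h2 := hv'.2
          rw [key] at h2
          refine Subtype.ext (funext fun j => ?_)
          rw [hi j]
          exact h2⟩
      exact ⟨w, fun s hs => by have := hw s hs; omega, hw'⟩
    -- No letter has degree below 2, so `v` is zero and nothing needs lifting.
    · refine ⟨0, fun s hs => absurd rfl hs, fun s' => ?_⟩
      have hs' : v s' = 0 := by
        by_contra h0
        have := hv s' h0
        omega
      simp [hs']

/-- The values of `h` are the entries of the first differential, whose image is the kernel of `Q →
R` by exactness. -/
theorem IsFreeResolution.mem_span_range_iff [Fintype (Σ n, κ (n + 1))] {R : Type u} [CommRing R]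
    [Algebra Q R] {aug : (κ 0 → Q) →ₗ[Q] R} (h : IsFreeResolution B aug) {i₀ : κ 0}
    (haug : ∀ v, aug v = algebraMap Q R (v i₀)) (r : Q) :
    r ∈ Ideal.span (Set.range fun x => (sigmaGen (κ := fun n => κ (n + 1))
      ((B 0).mulVecLin.codRestrict (LinearMap.ker aug) h.aug_mul) x).1 i₀) ↔
      algebraMap Q R r = 0 := by
  classical
  constructor
  · intro hr
    rw [← RingHom.mem_ker]
    refine Ideal.span_le.2 ?_ hr
    rintro _ ⟨x, rfl⟩
    rw [SetLike.mem_coe, RingHom.mem_ker, ← haug]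
    exact (sigmaGen (κ := fun n => κ (n + 1))
      ((B 0).mulVecLin.codRestrict (LinearMap.ker aug) h.aug_mul) x).2
  · intro hr
    obtain ⟨w, hw⟩ := h.aug_exact (fun _ => r) (by rw [haug, hr])
    rw [show r = (B 0).mulVec w i₀ by rw [hw]]
    refine sum_mem fun i _ => Ideal.mul_mem_right _ _ (Ideal.subset_span ⟨⟨0, i⟩, ?_⟩)
    change (B 0).mulVec (Pi.single i 1) i₀ = _
    rw [Matrix.mulVec_single_one]
    rfl

end Graded


/-! ### Counting words, and functions on words of one degree. -/

section Words

variable {S U : Type} {D : S → ℕ} {dg : U → ℕ}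

/-- The words of a given degree ending in an element of `U`. -/
abbrev Words (D : S → ℕ) (dg : U → ℕ) (n : ℕ) : Type :=
  {y : FreeMonoid S × U // totdeg D dg y = n}

theorem cons_injective {s s' : S} {y y' : FreeMonoid S × U} (h : cons s y = cons s' y') :
    s = s' ∧ y = y' := by
  obtain ⟨w, u⟩ := y
  obtain ⟨w', u'⟩ := y'
  obtain ⟨h1, h2⟩ := Prod.mk.inj h
  obtain ⟨h3, h4⟩ := List.cons.inj (congrArg FreeMonoid.toList h1)
  exact ⟨h3, Prod.ext (FreeMonoid.toList.injective h4) h2⟩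

/-- A word is an element of `U` or a letter followed by a word. -/
theorem words_bijective (D : S → ℕ) (dg : U → ℕ) (n : ℕ) : Function.Bijective
    (Sum.elim (fun u => ⟨(1, u.1), (zero_add _).trans u.2⟩)
      (fun p => ⟨cons p.1 p.2.1, (totdeg_cons D dg _ _).trans p.2.2⟩) :
      {u : U // dg u = n} ⊕ (Σ s : S, {y : FreeMonoid S × U // D s + totdeg D dg y = n}) →
        Words D dg n) := by
  constructor
  · rintro (⟨u, hu⟩ | ⟨s, y, hy⟩) (⟨u', hu'⟩ | ⟨s', y', hy'⟩) h
    · obtain rfl : u = u' := congrArg (fun x => x.1.2) h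
      rfl
    · exact absurd (congrArg (fun x => x.1.1.toList) h) (List.cons_ne_nil _ _).symm
    · exact absurd (congrArg (fun x => x.1.1.toList) h) (List.cons_ne_nil _ _)
    · obtain ⟨rfl, rfl⟩ := cons_injective (congrArg Subtype.val h)
      rfl
  · rintro ⟨y, hy⟩
    obtain ⟨u, rfl⟩ | ⟨s, y, rfl⟩ := word_cases y
    · exact ⟨Sum.inl ⟨u, (zero_add _).symm.trans hy⟩, rfl⟩
    · exact ⟨Sum.inr ⟨s, y, (totdeg_cons D dg _ _).symm.trans hy⟩, rfl⟩

/-- Removing the first letter lowers the degree, so strong induction applies. -/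
theorem finite_words [Finite S] [Finite U] (hD : ∀ s, 2 ≤ D s) (n : ℕ) :
    Finite (Words D dg n) := by
  induction n using Nat.strong_induction_on with
  | _ n ih =>
    have h : ∀ s : S, Finite {y : FreeMonoid S × U // D s + totdeg D dg y = n} := by
      intro s
      by_cases hs : D s ≤ n
      · have := ih (n - D s) (by have := hD s; omega)
        exact Finite.of_injective (β := Words D dg (n - D s))
          (fun y => ⟨y.1, by have := y.2; omega⟩) fun y y' h =>
          Subtype.ext (congrArg (fun z : Words D dg (n - D s) => z.1) h)
      · have : IsEmpty {y : FreeMonoid S × U // D s + totdeg D dg y = n} :=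
          ⟨fun y => hs (by have := y.2; omega)⟩
        infer_instance
    exact Finite.of_surjective _ (words_bijective D dg n).surjective

theorem card_words [Fintype S] [Finite U] (hD : ∀ s, 2 ≤ D s) (n : ℕ) :
    Nat.card (Words D dg n) = Nat.card {u // dg u = n} +
      ∑ s, if D s ≤ n then Nat.card (Words D dg (n - D s)) else 0 := by
  have hf := finite_words (D := D) (dg := dg) hD
  have h : ∀ s : S, Finite {y : FreeMonoid S × U // D s + totdeg D dg y = n} ∧
      Nat.card {y : FreeMonoid S × U // D s + totdeg D dg y = n} =
        if D s ≤ n then Nat.card (Words D dg (n - D s)) else 0 := by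
    intro s
    split_ifs with hs
    · have e : {y : FreeMonoid S × U // D s + totdeg D dg y = n} ≃ Words D dg (n - D s) :=
        Equiv.subtypeEquivRight fun y => by omega
      exact ⟨Finite.of_equiv _ e.symm, Nat.card_congr e⟩
    · have : IsEmpty {y : FreeMonoid S × U // D s + totdeg D dg y = n} :=
        ⟨fun y => hs (by have := y.2; omega)⟩
      exact ⟨inferInstance, Nat.card_of_isEmpty⟩
  have hfin := fun s => (h s).1
  rw [← Nat.card_congr (Equiv.ofBijective _ (words_bijective D dg n)), Nat.card_sum, Nat.card_sigma]
  simp only [(h _).2]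

/-- The generating function of the words. -/
noncomputable def wordSeries (D : S → ℕ) (dg : U → ℕ) : PowerSeries ℚ :=
  PowerSeries.mk fun n => (Nat.card (Words D dg n) : ℚ)

/-- The recursion on the first letter in generating-function form; it is the source of the Golod
denominator. -/
theorem wordSeries_mul [Fintype S] [Finite U] (hD : ∀ s, 2 ≤ D s) :
    wordSeries D dg * (1 - ∑ s, PowerSeries.X ^ D s) =
      PowerSeries.mk fun n => (Nat.card {u // dg u = n} : ℚ) := by
  rw [mul_sub, mul_one, sub_eq_iff_eq_add, Finset.mul_sum]
  ext n
  simp only [map_add, map_sum, PowerSeries.coeff_mul_X_pow', wordSeries, PowerSeries.coeff_mk]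
  rw [card_words hD]
  push_cast
  rfl

/-- A function on words of one degree, extended by zero. -/
def extendWords {R : Type u} [Zero R] (n : ℕ) (v : Words D dg n → R) (y : FreeMonoid S × U) : R :=
  if h : totdeg D dg y = n then v ⟨y, h⟩ else 0

theorem extendWords_apply {R : Type u} [Zero R] {n : ℕ} (v : Words D dg n → R)
    (y : Words D dg n) : extendWords n v y.1 = v y := dif_pos y.2

theorem extendWords_deg {R : Type u} [Zero R] {n : ℕ} (v : Words D dg n → R)
    (y : FreeMonoid S × U) (h : extendWords n v y ≠ 0) : totdeg D dg y = n := by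
  by_contra hne
  exact h (dif_neg hne)

theorem extendWords_restrict {R : Type u} [Zero R] {n : ℕ} {F : FreeMonoid S × U → R}
    (hF : ∀ y, F y ≠ 0 → totdeg D dg y = n) :
    extendWords n (fun y : Words D dg n => F y.1) = F := by
  funext y
  by_cases h : totdeg D dg y = n
  · exact dif_pos h
  · rw [extendWords, dif_neg h]
    by_contra hne
    exact h (hF y (Ne.symm hne))

theorem extendWords_injective {R : Type u} [Zero R] {n : ℕ} {v w : Words D dg n → R}
    (h : extendWords n v = extendWords n w) : v = w := by
  funext y
  rw [← extendWords_apply v, h, extendWords_apply]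

/-- Zero values are lifted to zero, so that the lift stays in one degree. -/
theorem exists_lift_words {Q R : Type u} [CommRing Q] [CommRing R] [Algebra Q R]
    (hR : Function.Surjective (algebraMap Q R)) {n : ℕ}
    {v : FreeMonoid S × U → R} (hv : ∀ x, v x ≠ 0 → totdeg D dg x = n) :
    ∃ F : FreeMonoid S × U → Q, (∀ x, F x ≠ 0 → totdeg D dg x = n) ∧
      (fun x => algebraMap Q R (F x)) = v := by
  classical
  choose F hF using fun x => hR (v x)
  refine ⟨fun x => if v x = 0 then 0 else F x, fun x hx => hv x fun h0 => hx (if_pos h0), ?_⟩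
  funext x
  change algebraMap Q R (if v x = 0 then 0 else F x) = v x
  split_ifs with h0
  · rw [map_zero, h0]
  · exact hF x

end Words

/-! ### The resulting free resolution over `R`. -/

section WordComplex

variable {Q : Type u} [CommRing Q] {S U : Type} [Fintype U] [DecidableEq U]
  {D : S → ℕ} {dg : U → ℕ}

/-- The matrices of the free resolution over the cyclic algebra. -/
noncomputable def wordMatrix (R : Type u) [CommRing R] [Algebra Q R] (D : S → ℕ)
    (dg : U → ℕ) (f : S → Tens Q S) (g : Matrix U U (Tens Q S)) (n : ℕ) :
    Matrix (Words D dg n) (Words D dg (n + 1)) R :=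
  Matrix.of fun y x => algebraMap Q R ((total D f g (bas Q y.1) x.1.2).coeff x.1.1)

/-- The augmentation of the free resolution over the cyclic algebra. -/
def wordAug {N : Type u} [AddCommGroup N] (R : Type u) [CommRing R] [Module R N] (D : S → ℕ)
    (dg : U → ℕ) (gen : U → N) : (Words D dg 0 → R) →ₗ[R] N where
  toFun v := ∑ u, extendWords 0 v (1, u) • gen u
  map_add' v w := by
    rw [← Finset.sum_add_distrib]
    refine Finset.sum_congr rfl fun u _ => ?_
    rw [← add_smul]
    congr 1
    simp only [extendWords]
    split_ifs
    · rfl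
    · rw [add_zero]
  map_smul' r v := by
    rw [RingHom.id_apply, Finset.smul_sum]
    refine Finset.sum_congr rfl fun u _ => ?_
    rw [smul_smul]
    congr 1
    simp only [extendWords]
    split_ifs
    · rfl
    · rw [mul_zero]

variable {R : Type u} [CommRing R] [Algebra Q R]

theorem pair_extendWords {n : ℕ} [Fintype (Words D dg n)] (v : Words D dg n → R)
    (e : U → Tens Q S) : pair (extendWords n v) e =
      ∑ x : Words D dg n, algebraMap Q R ((e x.1.2).coeff x.1.1) * v x := by
  classical
  let φ : (U → Tens Q S) →ₗ[Q] R := ∑ x : Words D dg n,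
    (LinearMap.toSpanSingleton Q R (v x)) ∘ₗ (Finsupp.lapply x.1.1) ∘ₗ
      (MonoidAlgebra.coeffLinearEquiv Q).toLinearMap ∘ₗ LinearMap.proj x.1.2
  have hφ : ∀ e, φ e = ∑ x : Words D dg n, algebraMap Q R ((e x.1.2).coeff x.1.1) * v x := by
    intro e
    simp only [φ, LinearMap.sum_apply]
    exact Finset.sum_congr rfl fun x _ => Algebra.smul_def _ _
  rw [← hφ]
  refine LinearMap.congr_fun (pi_linearMap_ext fun y => ?_) e
  rw [pair_bas, hφ]
  have hc : ∀ x : FreeMonoid S × U, (bas Q y x.2).coeff x.1 = if x = y then 1 else 0 := by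
    rintro ⟨w, u⟩
    by_cases hu : u = y.2
    · subst hu
      simp only [bas, Pi.single_eq_same, mon]
      by_cases hw : w = y.1
      · subst hw
        simp
      · rw [if_neg (fun h => hw (congrArg Prod.fst h))]
        simp [Ne.symm hw]
    · rw [if_neg (fun h => hu (congrArg Prod.snd h))]
      simp [bas, hu]
  simp only [hc]
  by_cases hy : totdeg D dg y = n
  · rw [Finset.sum_eq_single ⟨y, hy⟩]
    · simp [extendWords, hy]
    · intro x _ hx
      rw [if_neg (fun h => hx (Subtype.ext h)), map_zero, zero_mul]
    · simp
  · rw [extendWords, dif_neg hy, Finset.sum_eq_zero]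
    intro x _
    rw [if_neg, map_zero, zero_mul]
    rintro rfl
    exact hy x.2

theorem algebraMap_pair (F : FreeMonoid S × U → Q) (e : U → Tens Q S) :
    algebraMap Q R (pair F e) = pair (fun x => algebraMap Q R (F x)) e := by
  suffices h : Algebra.linearMap Q R ∘ₗ pair F = pair fun x => algebraMap Q R (F x) from
    LinearMap.congr_fun h e
  exact pi_linearMap_ext fun y => by simp [pair_bas]

variable [Fintype S] {N : Type u} [AddCommGroup N] [Module Q N]
  {d : S → S → Q} {h : S → Q} {e : U → U → Q} {gen : U → N} {f : S → Tens Q S}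
  {g : Matrix U U (Tens Q S)}

namespace IsTwisting

/-- The square is contraction with `h`, which maps to zero in `R`. -/
theorem transp_transp_eq_zero (T : IsTwisting D d h dg e gen f g)
    (hker : ∀ s, algebraMap Q R (h s) = 0) (v : FreeMonoid S × U → R) :
    transp D f g (transp D f g v) = 0 := by
  funext y
  rw [GolodBound.transp_transp T.f_mem T.f_rel T.g_rel]
  exact Finset.sum_eq_zero fun s _ => by rw [Algebra.smul_def, hker, zero_mul]

theorem extendWords_mulVec [∀ n, Fintype (Words D dg n)] (T : IsTwisting D d h dg e gen f g) (n : ℕ)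
    (v : Words D dg (n + 1) → R) :
    extendWords n ((wordMatrix R D dg f g n).mulVec v) =
      transp D f g (extendWords (n + 1) v) := by
  funext y
  by_cases hy : totdeg D dg y = n
  · rw [extendWords, dif_pos hy, transp, pair_extendWords]
    rfl
  · rw [extendWords, dif_neg hy]
    refine (transp_eq_zero T.f_mem T.g_mem fun x hx => ?_).symm
    refine dif_neg fun h0 => hy ?_
    omega

variable [Module R N] [IsScalarTower Q R N]

/-- Exactness of the complex of functions on words with values in the cyclic algebra. -/
theorem exact_words (T : IsTwisting D d h dg e gen f g)
    (hR : Function.Surjective (algebraMap Q R))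
    (hker : ∀ r, algebraMap Q R r = 0 → r ∈ Ideal.span (Set.range h)) {n : ℕ}
    {v : FreeMonoid S × U → R} (hv : ∀ x, v x ≠ 0 → totdeg D dg x = n)
    (htr : transp D f g v = 0) (hgen : ∑ u, v (1, u) • gen u = 0) :
    ∃ F : FreeMonoid S × U → R, (∀ x, F x ≠ 0 → totdeg D dg x = n + 1) ∧ transp D f g F = v := by
  obtain ⟨v, hv', rfl⟩ := exists_lift_words hR hv
  obtain ⟨F, hF, hF'⟩ := T.exact hv'
    (fun y => hker _ (by
      rw [transp, algebraMap_pair]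
      exact congrFun htr y))
    (by
      rw [← hgen]
      exact Finset.sum_congr rfl fun u _ => (algebraMap_smul R _ _).symm)
  refine ⟨fun x => algebraMap Q R (F x), fun x hx => hF x fun h0 => hx ?_, ?_⟩
  · change algebraMap Q R (F x) = 0
    rw [h0, map_zero]
  funext y
  rw [transp, ← algebraMap_pair]
  exact congrArg _ (congrFun hF' y)

/-- In degree 1 there are no letters, so the claim is `d_gen` for the module resolution. -/
theorem augmentation_transp (T : IsTwisting D d h dg e gen f g)
    (hR : Function.Surjective (algebraMap Q R)) {v : FreeMonoid S × U → R}
    (hv : ∀ x, v x ≠ 0 → totdeg D dg x = 1) :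
    ∑ u, transp D f g v (1, u) • gen u = 0 := by
  obtain ⟨v, hv', rfl⟩ := exists_lift_words hR hv
  have h1 : ∀ u, transp D f g (fun x => algebraMap Q R (v x)) (1, u) • gen u =
      ∑ u', (v (1, u') * e u' u) • gen u := by
    intro u
    rw [transp, ← algebraMap_pair, ← transp, algebraMap_smul, T.transp_one, Finset.sum_smul]
    · exact Finset.sum_congr rfl fun u' _ => by rw [mul_comm]
    · intro s y
      by_contra h0
      have h2 := hv' _ h0
      have h3 := T.alg.two_le s
      rw [totdeg_cons] at h2
      omega
  simp only [h1]
  rw [Finset.sum_comm]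
  refine Finset.sum_eq_zero fun u' _ => ?_
  simp only [mul_smul]
  rw [← Finset.smul_sum, T.mod.d_gen, smul_zero]

variable [∀ n, Fintype (Words D dg n)]

theorem isFreeResolution (T : IsTwisting D d h dg e gen f g)
    (hR : Function.Surjective (algebraMap Q R))
    (hker : ∀ r, algebraMap Q R r = 0 ↔ r ∈ Ideal.span (Set.range h))
    (hgen : ∀ x : N, ∃ v : U → Q, ∑ u, v u • gen u = x) :
    IsFreeResolution (wordMatrix R D dg f g) (wordAug R D dg gen) where
  surj x := by
    obtain ⟨v, rfl⟩ := hgen x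
    refine ⟨fun y => algebraMap Q R (v y.1.2), Finset.sum_congr rfl fun u _ => ?_⟩
    by_cases hu : dg u = 0
    · rw [extendWords, dif_pos (by simpa [totdeg] using hu), algebraMap_smul]
    · rw [not_imp_comm.1 (T.mod.gen_deg u) hu, smul_zero, smul_zero]
  aug_mul v := by
    change ∑ u, extendWords 0 _ (1, u) • gen u = 0
    rw [T.extendWords_mulVec]
    exact T.augmentation_transp hR (extendWords_deg v)
  aug_exact v hv := by
    obtain ⟨F, hF, hF'⟩ := T.exact_words hR (fun r => (hker r).1) (extendWords_deg v) (by
      funext y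
      refine transp_eq_zero T.f_mem T.g_mem fun x hx => dif_neg ?_
      omega) hv
    refine ⟨fun y => F y.1, extendWords_injective ?_⟩
    rw [T.extendWords_mulVec, extendWords_restrict hF, hF']
  mul_mul n v := by
    apply extendWords_injective
    rw [T.extendWords_mulVec, T.extendWords_mulVec, T.transp_transp_eq_zero fun s =>
      (hker _).2 (Ideal.subset_span ⟨s, rfl⟩)]
    funext y
    rw [extendWords]
    split_ifs <;> rfl
  exact n v hv := by
    obtain ⟨F, hF, hF'⟩ := T.exact_words hR (fun r => (hker r).1) (extendWords_deg v) (by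
      rw [← T.extendWords_mulVec, hv]
      funext y
      rw [extendWords]
      split_ifs <;> rfl)
      (Finset.sum_eq_zero fun u _ => by
        by_cases hu : dg u = 0
        · rw [extendWords, dif_neg (by simp [totdeg, hu]), zero_smul]
        · rw [not_imp_comm.1 (T.mod.gen_deg u) hu, smul_zero])
    refine ⟨fun y => F y.1, extendWords_injective ?_⟩
    rw [T.extendWords_mulVec, extendWords_restrict hF, hF']

end IsTwisting

end WordComplex


/-! ### Minimality of the word resolution and the Golod bound. -/

section Main

open IsLocalRing

theorem mem_smul_top_iff {Q : Type u} [CommRing Q] {S : Type} {I : Ideal Q} {t : Tens Q S} :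
    t ∈ I • (⊤ : Submodule Q (Tens Q S)) ↔ ∀ w, t.coeff w ∈ I := by
  constructor
  · intro ht w
    have h := Submodule.mem_map_of_mem (f := Finsupp.lapply w ∘ₗ
      (MonoidAlgebra.coeffLinearEquiv Q (M := FreeMonoid S)).toLinearMap) ht
    rw [Submodule.map_smul''] at h
    exact Ideal.mul_le_left (I := I) (J := Submodule.map _ ⊤) h
  · intro h
    have ht : t = ∑ w ∈ t.coeff.support, t.coeff w • mon Q w := by
      conv_lhs => rw [← MonoidAlgebra.sum_coeff_single t]
      simp [Finsupp.sum, mon]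
    rw [ht]
    exact sum_mem fun w _ => Submodule.smul_mem_smul (h w) trivial

theorem map_mem_smul_top {Q : Type u} [CommRing Q] {N N' : Type*} [AddCommGroup N] [Module Q N]
    [AddCommGroup N'] [Module Q N'] {I : Ideal Q} (φ : N →ₗ[Q] N') {x : N}
    (hx : x ∈ I • (⊤ : Submodule Q N)) : φ x ∈ I • (⊤ : Submodule Q N') := by
  have h := Submodule.mem_map_of_mem (f := φ) hx
  rw [Submodule.map_smul''] at h
  exact Submodule.smul_mono le_rfl le_top h

/-- By the Leibniz rule, a derivation vanishing modulo `I` on letters vanishes modulo `I`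
everywhere. -/
theorem deriv_mem_smul_top {Q : Type u} [CommRing Q] {I : Ideal Q} {S : Type} {D : S → ℕ}
    {f : S → Tens Q S}
    (hf : ∀ s, f s ∈ I • (⊤ : Submodule Q (Tens Q S))) (t : Tens Q S) :
    deriv D f t ∈ I • (⊤ : Submodule Q (Tens Q S)) := by
  refine mem_of_supported (X := Set.univ) (fun w _ => ?_) (t := t) fun _ _ => trivial
  induction w using FreeMonoid.inductionOn' with
  | one =>
    rw [mon_one, deriv_one]
    exact zero_mem _
  | of_mul s w ih =>
    rw [deriv_of_mul]
    exact add_mem (map_mem_smul_top (LinearMap.mulRight Q _) (hf s))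
      (Submodule.smul_mem _ _ (map_mem_smul_top (LinearMap.mulLeft Q _) (ih trivial)))

section Reduction

variable {Q : Type u} [CommRing Q] {S U : Type} [Fintype U]
  {D : S → ℕ} {dg : U → ℕ} {f : S → Tens Q S} {g : Matrix U U (Tens Q S)} {I : Ideal Q}

theorem total_mem_smul_top (hf : ∀ s, f s ∈ I • (⊤ : Submodule Q (Tens Q S)))
    (hg : ∀ u v, g u v ∈ I • (⊤ : Submodule Q (Tens Q S))) (e : U → Tens Q S) (v : U) :
    total D f g e v ∈ I • (⊤ : Submodule Q (Tens Q S)) :=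
  add_mem (deriv_mem_smul_top hf _)
    (sum_mem fun u _ => map_mem_smul_top (LinearMap.mulLeft Q _) (hg u v))

variable [DecidableEq U]

/-- If the differential vanishes modulo `I` on words of small degree, it vanishes modulo `I`. -/
theorem total_mem_smul_top_of_le {c : ℕ} {u₀ : U} (hu₀ : dg u₀ = 0) (hD : ∀ s, D s ≤ c)
    (hdg : ∀ u, dg u ≤ c)
    (hc : ∀ y v, totdeg D dg y ≤ c →
      total D f g (bas Q y) v ∈ I • (⊤ : Submodule Q (Tens Q S)))
    (e : U → Tens Q S) (v : U) : total D f g e v ∈ I • (⊤ : Submodule Q (Tens Q S)) := by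
  have hg : ∀ u v, g u v ∈ I • (⊤ : Submodule Q (Tens Q S)) := by
    intro u v
    have h := hc (1, u) v (by simpa [totdeg] using hdg u)
    rwa [total_bas_one] at h
  refine total_mem_smul_top (fun s => ?_) hg e v
  -- The differential of `s · u₀` is `f s · u₀` plus a term in `g`, already known to vanish modulo
  -- `I`. As `dg u₀ = 0`, the word has degree `D s`, within the bound.
  have h := hc (cons s (1, u₀)) u₀ (by simpa [totdeg, cons, hu₀] using hD s)
  rw [← letter_smul_bas, total_smul, deriv_letter, total_bas_one] at h
  have h2 : f s = (f s • bas Q (1, u₀) + sgn D (letter Q s) • g u₀ : U → Tens Q S) u₀ -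
      sgn D (letter Q s) * g u₀ u₀ := by
    simp [bas, mon_one]
  rw [h2]
  exact sub_mem h (map_mem_smul_top (LinearMap.mulLeft Q _) (hg _ _))

end Reduction

theorem eq_zero_of_rank_eq_zero {K m n : Type*} [Field K] [Fintype n] [Fintype m]
    {B : Matrix m n K} (h : B.rank = 0) : B = 0 := by
  classical
  have h1 : LinearMap.range B.mulVecLin = ⊥ := Submodule.finrank_eq_zero.1 h
  ext i j
  have h2 := LinearMap.congr_fun (LinearMap.range_eq_bot.1 h1) (Pi.single j 1)
  rw [Matrix.mulVecLin_apply, Matrix.mulVec_single_one] at h2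
  exact congrFun h2 i

section

variable {Q R : Type u} [CommRing Q] [IsLocalRing Q] [CommRing R] [IsLocalRing R] [Algebra Q R]
  {N : Type u} [AddCommGroup N] [Module Q N] [Module R N] [IsScalarTower Q R N]
  {S U : Type} [Fintype S] [Fintype U] [DecidableEq U] {D : S → ℕ} {dg : U → ℕ}
  {d : S → S → Q} {h : S → Q} {e : U → U → Q} {gen : U → N} {f : S → Tens Q S}
  {g : Matrix U U (Tens Q S)}

/-- The criterion for equality in the Golod bound, in terms of a twisting. -/
theorem IsTwisting.isGolodModule (T : IsTwisting D d h dg e gen f g)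
    (hR : Function.Surjective (algebraMap Q R))
    (hker : ∀ r, algebraMap Q R r = 0 ↔ r ∈ Ideal.span (Set.range h))
    (hgen : ∀ x : N, ∃ v : U → Q, ∑ u, v u • gen u = x) {c : ℕ} (hD : ∀ s, D s ≤ c)
    (hdg : ∀ u, dg u ≤ c) (hu : Nonempty U → ∃ u₀, dg u₀ = 0)
    (hW : golodBound Q R N = wordSeries D dg) (heq : GolodBoundEqUpTo Q R N c) :
    IsGolodModule Q R N := by
  have hfin := finite_words (D := D) (dg := dg) T.alg.two_le
  let _ : ∀ n, Fintype (Words D dg n) := fun n => Fintype.ofFinite _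
  have H := T.isFreeResolution hR hker hgen
  have hloc : IsLocalHom (algebraMap Q R) := IsLocalHom.of_surjective _ hR
  have hmem : ∀ a : Q, residue R (algebraMap Q R a) = 0 ↔ a ∈ maximalIdeal Q := by
    intro a
    rw [residue_eq_zero_iff, mem_maximalIdeal, mem_maximalIdeal, mem_nonunits_iff,
      mem_nonunits_iff, isUnit_map_iff]
  have hcoeff : ∀ n, PowerSeries.coeff n (golodBound Q R N) = Fintype.card (Words D dg n) := by
    intro n
    rw [hW, wordSeries, PowerSeries.coeff_mk, Nat.card_eq_fintype_card]
  have htor : ∀ n ≤ c, Module.finrank (ResidueField R) (residueTor R N n) =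
      Fintype.card (Words D dg n) := by
    intro n hn
    have h1 := heq n hn
    rw [hcoeff, poincareSeries, PowerSeries.coeff_mk] at h1
    exact_mod_cast h1
  -- The Tor dimension equals the number of words, which leaves rank zero for the reduced matrices.
  have hrank : ∀ n ≤ c, (wordMatrix R D dg f g n).map (residue R) = 0 := by
    intro n hn
    apply eq_zero_of_rank_eq_zero
    have h1 := htor n hn
    cases n with
    | zero =>
      have h2 := H.finrank_residueTor_zero
      omega
    | succ n =>
      have h2 := H.finrank_residueTor_succ n
      omega
  have htot : ∀ y v, total D f g (bas Q y) v ∈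
      maximalIdeal Q • (⊤ : Submodule Q (Tens Q S)) := by
    intro y v
    obtain ⟨u₀, hu₀⟩ := hu ⟨v⟩
    refine total_mem_smul_top_of_le hu₀ hD hdg (fun y v hy => mem_smul_top_iff.2 fun w => ?_) _ v
    by_cases hw : (total D f g (bas Q y) v).coeff w = 0
    · rw [hw]
      exact zero_mem _
    · have hdeg := total_bas_deg T.f_mem T.g_mem y v w hw
      exact (hmem _).1 (congrFun (congrFun (hrank _ hy) ⟨y, rfl⟩) ⟨(w, v), hdeg⟩)
  have hzero : ∀ n, (wordMatrix R D dg f g n).map (residue R) = 0 := by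
    intro n
    ext y x
    exact (hmem _).2 (mem_smul_top_iff.1 (htot y.1 x.1.2) x.1.1)
  refine PowerSeries.ext fun n => ?_
  rw [hcoeff, poincareSeries, PowerSeries.coeff_mk, Nat.cast_inj]
  cases n with
  | zero =>
    have h2 := H.finrank_residueTor_zero
    rwa [hzero, Matrix.rank_zero, add_zero] at h2
  | succ n =>
    have h2 := H.finrank_residueTor_succ n
    rwa [hzero, hzero, Matrix.rank_zero, Matrix.rank_zero, add_zero, add_zero] at h2

end

/-- A graded family vanishing in large degrees is finite. -/
theorem finite_sigma_of_isEmpty {κ : ℕ → Type} [∀ n, Finite (κ n)] {c : ℕ}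
    (h : ∀ n, c < n → IsEmpty (κ n)) : Finite (Σ n, κ n) := by
  have hle : ∀ x : Σ n, κ n, x.1 < c + 1 := fun x => by
    by_contra hx
    exact (h x.1 (by omega)).false x.2
  exact Finite.of_injective (β := Σ n : Fin (c + 1), κ n) (fun x => ⟨⟨x.1, hle x⟩, x.2⟩) (by
    rintro ⟨n, i⟩ ⟨m, j⟩ hx
    obtain ⟨h1, h2⟩ := Sigma.mk.inj hx
    obtain rfl : n = m := congrArg Fin.val h1
    exact congrArg (Sigma.mk n) (eq_of_heq h2))

theorem card_sigma_fiber {κ : ℕ → Type} (n : ℕ) :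
    Nat.card {x : Σ n, κ n // x.1 = n} = Nat.card (κ n) :=
  (Nat.card_congr (Equiv.ofBijective (fun i : κ n => (⟨⟨n, i⟩, rfl⟩ : {x : Σ n, κ n // x.1 = n}))
    ⟨fun _ _ h => sigma_mk_injective (congrArg Subtype.val h), by
      rintro ⟨⟨m, i⟩, rfl⟩
      exact ⟨i, rfl⟩⟩)).symm

variable {Q R M : Type u} [CommRing Q] [IsLocalRing Q] [CommRing R] [Algebra Q R]
  [AddCommGroup M] [Module Q M] {ι κ : ℕ → Type} [∀ n, Fintype (ι n)] [∀ n, Fintype (κ n)]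
  {A : ∀ n, Matrix (ι n) (ι (n + 1)) Q} {augR : (ι 0 → Q) →ₗ[Q] R}
  {B : ∀ n, Matrix (κ n) (κ (n + 1)) Q} {augM : (κ 0 → Q) →ₗ[Q] M}

theorem poincareSeries_eq (hB : IsFreeResolution B augM) (hBm : IsMinimal B) :
    poincareSeries Q M = PowerSeries.mk fun n => (Nat.card (κ n) : ℚ) := by
  refine PowerSeries.ext fun n => ?_
  rw [poincareSeries, PowerSeries.coeff_mk, PowerSeries.coeff_mk,
    hB.finrank_residueTor_of_isMinimal hBm, Nat.card_eq_fintype_card]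

/-- The resolution of `R` has rank one in degree zero, which cancels the constant 1. A basis element
in homological degree `n + 1` contributes `t ^ (n + 2)` because of the extra factor `t`. -/
theorem golodDenominator_eq [Fintype (Σ n, ι (n + 1))] (hA : IsFreeResolution A augR)
    (hAm : IsMinimal A) {i₀ : ι 0} (hi : ∀ j, j = i₀) :
    golodDenominator Q R = 1 - ∑ s : Σ n, ι (n + 1), PowerSeries.X ^ (s.1 + 2) := by
  have h0 : Nat.card (ι 0) = 1 := Nat.card_eq_one_iff_exists.2 ⟨i₀, hi⟩
  rw [golodDenominator, poincareSeries_eq hA hAm]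
  congr 1
  ext n
  rw [map_sum]
  simp only [PowerSeries.coeff_X_pow]
  cases n with
  | zero =>
    rw [PowerSeries.coeff_zero_X_mul]
    exact (Finset.sum_eq_zero fun s _ => if_neg (by omega)).symm
  | succ n =>
    rw [PowerSeries.coeff_succ_X_mul, map_sub, PowerSeries.coeff_mk, PowerSeries.coeff_one]
    cases n with
    | zero =>
      rw [h0, if_pos rfl, Nat.cast_one, sub_self]
      exact (Finset.sum_eq_zero fun s _ => if_neg (by omega)).symm
    | succ n =>
      rw [if_neg (Nat.succ_ne_zero n), sub_zero,
        sum_sigma_eq (κ := fun n => ι (n + 1)) n fun m i hm => if_neg (by simpa using hm.symm)]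
      simp

theorem golodBound_eq [Fintype (Σ n, ι (n + 1))] [Finite (Σ n, κ n)]
    (hA : IsFreeResolution A augR) (hAm : IsMinimal A) {i₀ : ι 0} (hi : ∀ j, j = i₀)
    (hB : IsFreeResolution B augM) (hBm : IsMinimal B) :
    golodBound Q R M =
      wordSeries (fun s : Σ n, ι (n + 1) => s.1 + 2) (fun x : Σ n, κ n => x.1) := by
  have h0 : golodDenominator Q R ≠ 0 := by
    intro h
    have := congrArg (PowerSeries.constantCoeff (R := ℚ)) h
    simp [golodDenominator] at this
  refine mul_right_cancel₀ h0 ?_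
  rw [golodBound_mul_golodDenominator, golodDenominator_eq hA hAm hi,
    wordSeries_mul fun s => Nat.le_add_left _ _, poincareSeries_eq hB hBm]
  simp only [card_sigma_fiber]

/-- If degree zero is empty, minimality and exactness empty each later degree in turn. This supplies
the element `u₀` of degree zero. -/
theorem IsFreeResolution.nonempty_zero (hB : IsFreeResolution B augM) (hBm : IsMinimal B)
    (h : Nonempty (Σ n, κ n)) : Nonempty (κ 0) := by
  by_contra h0
  rw [not_nonempty_iff] at h0
  have hall : ∀ n, IsEmpty (κ n) := by
    intro n
    induction n with
    | zero => exact h0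
    | succ n ih =>
      exact hBm.isEmpty_of_forall (n + 1) fun v => hB.exact n v (funext fun i => ih.elim i)
  obtain ⟨⟨n, i⟩⟩ := h
  exact (hall n).false i

variable [IsLocalRing R] [Module R M] [IsScalarTower Q R M]

/-- Equality in the Golod bound up to degree `c + 1` implies equality, if the minimal resolutions
over `Q` of the algebra and of the module vanish beyond degrees `c` and `c + 1`. -/
theorem isGolodModule_of_isFreeResolution (hR : Function.Surjective (algebraMap Q R))
    (hA : IsFreeResolution A augR) (hAm : IsMinimal A) {i₀ : ι 0} (hi : ∀ j, j = i₀)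
    (haug : ∀ v, augR v = algebraMap Q R (v i₀))
    (hB : IsFreeResolution B augM) (hBm : IsMinimal B) {c : ℕ}
    (hAc : ∀ n, c < n → IsEmpty (ι n)) (hBc : ∀ n, c + 1 < n → IsEmpty (κ n))
    (heq : GolodBoundEqUpTo Q R M (c + 1)) : IsGolodModule Q R M := by
  classical
  have hS : Finite (Σ n, ι (n + 1)) :=
    finite_sigma_of_isEmpty (κ := fun n => ι (n + 1)) (c := c) fun n hn => hAc _ (by omega)
  have hU : Finite (Σ n, κ n) := finite_sigma_of_isEmpty hBc
  let _ := Fintype.ofFinite (Σ n, ι (n + 1))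
  let _ := Fintype.ofFinite (Σ n, κ n)
  have hker := hA.mem_span_range_iff haug
  obtain ⟨f, g, T⟩ := exists_twisting (hA.isCyclicResolution hi) hB.isModuleResolution
    fun s m => by
      rw [← algebraMap_smul R, (hker _).1 (Ideal.subset_span ⟨s, rfl⟩), zero_smul]
  refine T.isGolodModule hR (fun r => (hker r).symm) (fun x => ?_) (c := c + 1) (fun s => ?_)
    (fun u => ?_) (fun h => ?_) (golodBound_eq hA hAm hi hB hBm) heq
  · obtain ⟨v, rfl⟩ := hB.surj x
    refine ⟨place 0 v, ?_⟩
    rw [sum_smul_sigmaGen]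
    congr 1
  · by_contra hs
    exact (hAc (s.1 + 1) (by omega)).false s.2
  · by_contra hu
    exact (hBc u.1 (by omega)).false u.2
  · obtain ⟨i⟩ := hB.nonempty_zero hBm h
    exact ⟨⟨0, i⟩, rfl⟩

end Main

end GolodBound

theorem mainTheorem3 (Q R M : Type u) [CommRing Q] [IsLocalRing Q] [IsNoetherianRing Q]
    [CommRing R] [IsLocalRing R] [Algebra Q R]
    (hφ : Function.Surjective (algebraMap Q R))
    [AddCommGroup M] [Module Q M] [Module R M] [IsScalarTower Q R M] [Module.Finite R M] :
    (∀ c : ℕ,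
      max (projectiveDimension (ModuleCat.of Q R) + 1) (projectiveDimension (ModuleCat.of Q M))
        = (c : WithBot ℕ∞) + 1 →
      GolodBoundEqUpTo Q R M (c + 1) → IsGolodModule Q R M) ∧
    (IsRegularLocalRing Q → ∀ d : ℕ, ringKrullDim Q = (d : WithBot ℕ∞) →
      GolodBoundEqUpTo Q R M (d + 1) → IsGolodModule Q R M) := by
  have hfinR : Module.Finite Q R := Module.Finite.of_surjective (Algebra.linearMap Q R) hφ
  have hfinM : Module.Finite Q M := Module.Finite.trans R M
  obtain ⟨r, A, augR, hA, hAm, i₀, hi, haug⟩ := GolodBound.exists_minimal_resolution_cyclic R hφ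
  obtain ⟨m, B, augM, hB, hBm⟩ := GolodBound.exists_minimal_resolution (Q := Q) M
  constructor
  · intro c hc heq
    have hpR : HasProjectiveDimensionLE (ModuleCat.of Q R) c := by
      rw [← projectiveDimension_le_iff, ← ENat.WithBot.add_le_add_one_right_iff, ← hc]
      exact le_max_left _ _
    -- The hypothesis on `c` has 1 added to both sides, so no subtraction occurs in `WithBot ℕ∞`,
    -- and it bounds the projective dimension of `M` by `c + 1`.
    have hpM : HasProjectiveDimensionLE (ModuleCat.of Q M) (c + 1) := by
      rw [← projectiveDimension_le_iff, Nat.cast_add, Nat.cast_one, ← hc]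
      exact le_max_right _ _
    refine GolodBound.isGolodModule_of_isFreeResolution hφ hA hAm hi haug hB hBm
      (fun n hn => ?_) (fun n hn => ?_) heq
    · obtain ⟨n, rfl⟩ := Nat.exists_eq_succ_of_ne_zero (Nat.ne_of_gt (Nat.zero_lt_of_lt hn))
      exact hA.isEmpty_of_hasProjectiveDimensionLT n hAm
        (hasProjectiveDimensionLT_of_ge _ (c + 1) _ (by omega))
    · obtain ⟨n, rfl⟩ := Nat.exists_eq_succ_of_ne_zero (Nat.ne_of_gt (Nat.zero_lt_of_lt hn))
      exact hB.isEmpty_of_hasProjectiveDimensionLT n hBm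
        (hasProjectiveDimensionLT_of_ge _ (c + 2) _ (by omega))
  · intro hreg d hd heq
    refine GolodBound.isGolodModule_of_isFreeResolution hφ hA hAm hi haug hB hBm
      (fun n hn => ?_) (fun n hn => ?_) heq
    · exact GolodBound.isEmpty_of_isRegularLocalRing d hd hAm hA.mul_mul hA.exact n hn
    -- The resolution of `M` already stops at `d`, one better than needed.
    · exact GolodBound.isEmpty_of_isRegularLocalRing d hd hBm hB.mul_mul hB.exact n (by omega)
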